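/- Let $\Omega\subset\mathbb R^2$ be an open set of finite area (for example a bounded domain with Lipschitz boundary), $T>0$, $\Omega_T=\Omega\times(0,T)$, $\mu>0$ and $\tau_y\ge 0$. Let $$H=\{v\in L^2(\Omega)^2:\ \nabla\cdot v=0,\ v\cdot n|_{\partial\Omega}=0\},\qquad V=\{v\in H^1_0(\Omega)^2:\ \nabla\cdot v=0\},$$ with the norms $\|v\|_H=\|v\|_{L^2(\Omega)}$ and $\|v\|_V=\|\nabla v\|_{L^2(\Omega)}$, where the conditions defining $H$ are understood in the weak sense $\int_\Omega v\cdot\nabla q\,dx=0$ for all $q\in H^1(\Omega)$. Let $V'$ be the dual of $V$, with the dual norm, and let $V\subset H\subset V'$ be identified through the inner product of $H$. For $m\ge 2$ and $A\in\mathbb R^{2\times2}$ put $|A|^2=A:A$, $\gamma_m=\frac{\tau_y}{2\mu(m-1)}$ and $$\tau_m(A)=2m\mu A\ \text{ if } |A|\le\gamma_m,\qquad \tau_m(A)=\Big(2\mu+\frac{\tau_y}{|A|}\Big)A\ \text{ if } |A|>\gamma_m,$$ and write $Dv=\frac12(\nabla v+\nabla v^t)$. Let $f\in L^2(0,T;V')$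 and $u_0\in H$. There is a constant $C$, depending only on $\Omega,T,\mu,\tau_y,f,u_0$, such that for every integer $m\ge2$ and every solution $u_m$ of the approximate problem, that is, every $u_m\in L^2(0,T;V)$ with $\partial_t u_m\in L^2(0,T;V')$ that is continuous from $[0,T]$ to $H$ (up to modification on a null set of times), has $u_m(0)=u_0$, and satisfies $$\int_0^T\langle\partial_tu_m,\varphi\rangle\,dt+\int_0^T\!\!\int_\Omega\tau_m(Du_m):D\varphi\,dx\,dt+\int_0^T\!\!\int_\Omega (u_m\cdot\nabla)u_m\cdot\varphi\,dx\,dt=\int_0^T\langle f,\varphi\rangle\,dt\qquad\text{for all }\varphi\in L^2(0,T;V),$$ the following hold. (i) $u_m\in L^2(0,T;V)\cap L^\infty(0,T;H)$, with $\|u_m\|_{L^2(0,T;V)}\le C$ and $\|u_m\|_{L^\infty(0,T;H)}\le C$. (ii) For almost every $t$, $\varphi\mapsto\int_\Omega (u_m(t)\cdot\nabla)u_m(t)\cdot\varphi\,dx$ is an absolutely convergent integral for all $\varphi\in V$ and defines an element of $V'$; the resulting function $(u_m\cdot\nabla)u_m$ belongs to $L^2(0,T;V')$, with norm at most $C$.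 (iii) $\tau_m(Du_m)\in L^2(\Omega_T)$, with norm at most $C$. (iv) $\partial_tu_m\in L^2(0,T;V')$, with norm at most $C$. -/

import Mathlib

open MeasureTheory Set Filter Topology TopologicalSpace
open scoped Distributions ContDiff ENNReal RealInnerProductSpace

noncomputable section

namespace Bingham

/-- The plane `ℝ²` with its Euclidean structure. -/
abbrev Plane := EuclideanSpace ℝ (Fin 2)

/-- Real `2 × 2` matrices with the inner product `A : B = ∑ i j, A i j * B i j` and the norm
`|A| = (A : A) ^ (1 / 2)`; the entry in row `i` and column `j` is `A (i, j)`. -/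
abbrev Mat := EuclideanSpace ℝ (Fin 2 × Fin 2)

/-- The trace of a matrix. -/
def tr (A : Mat) : ℝ := A (0, 0) + A (1, 1)

/-- The symmetric part `(A + Aᵀ) / 2`. -/
def symPart (A : Mat) : Mat :=
  WithLp.toLp 2 fun p => (A (p.1, p.2) + A (p.2, p.1)) / 2

/-- The Jacobian matrix of `φ` at `x`: its entry `(i, j)` is `∂ⱼ φᵢ (x)`. -/
def jac (φ : Plane → Plane) (x : Plane) : Mat :=
  WithLp.toLp 2 fun p => fderiv ℝ φ x (EuclideanSpace.single p.2 1) p.1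

/-- `L²(Ω)`. -/
abbrev L2scal (Ω : Opens Plane) := Lp ℝ 2 (volume.restrict (Ω : Set Plane))

/-- `L²(Ω)²`. -/
abbrev L2vec (Ω : Opens Plane) := Lp Plane 2 (volume.restrict (Ω : Set Plane))

/-- `L²(Ω)` for functions with values in the `2 × 2` matrices. -/
abbrev L2mat (Ω : Opens Plane) := Lp Mat 2 (volume.restrict (Ω : Set Plane))

/-! ### The space `H` -/

/-- `r` is the weak gradient in `Ω` of the scalar function `q` (so that `q ∈ H¹(Ω)`). -/
def IsWeakGrad {Ω : Opens Plane} (q : L2scal Ω) (r : L2vec Ω) : Prop :=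
  ∀ φ : 𝓓(Ω, Plane), ∫ x in (Ω : Set Plane), ⟪r x, φ x⟫ =
    -∫ x in (Ω : Set Plane), q x * tr (jac φ x)

/-- The space `H` of the `v ∈ L²(Ω)²` with `∇ · v = 0` in `Ω` and `v · n = 0` on `∂Ω`. The normal
trace of a field `v` is the functional `q ↦ ∫ v · ∇q + ∫ (∇ · v) q` on `H¹(Ω)`; hence both
conditions together say that `∫ v · ∇q = 0` for all `q ∈ H¹(Ω)` (for `q` a test function in `Ω`
this is `∇ · v = 0`). -/
def H (Ω : Opens Plane) : Submodule ℝ (L2vec Ω) where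
  carrier := {v | ∀ (q : L2scal Ω) (r : L2vec Ω), IsWeakGrad q r → ⟪v, r⟫ = 0}
  zero_mem' := fun q r _ => inner_zero_left r
  add_mem' := fun {v w} hv hw q r h => by rw [inner_add_left, hv q r h, hw q r h, add_zero]
  smul_mem' := fun c v hv q r h => by rw [real_inner_smul_left, hv q r h, mul_zero]

/-! ### The space `V` -/

/-- The pairs `(φ, ∇φ)`, where `φ` is a test function in `Ω`. -/
def testGraph (Ω : Opens Plane) : Submodule ℝ (L2vec Ω × L2mat Ω) where
  carrier := {p | ∃ φ : 𝓓(Ω, Plane), p.1 =ᵐ[volume.restrict (Ω : Set Plane)] φ ∧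
    p.2 =ᵐ[volume.restrict (Ω : Set Plane)] jac φ}
  zero_mem' := by
    refine ⟨0, Lp.coeFn_zero _ _ _, ?_⟩
    filter_upwards [Lp.coeFn_zero Mat 2 (volume.restrict (Ω : Set Plane))] with x hx
    rw [Prod.snd_zero, hx]
    ext p
    simp [jac]
  add_mem' := by
    rintro a b ⟨φ, h1, h2⟩ ⟨ψ, h3, h4⟩
    refine ⟨φ + ψ, ?_, ?_⟩
    · filter_upwards [Lp.coeFn_add a.1 b.1, h1, h3] with x hx h1 h3
      rw [Prod.fst_add, hx]
      simp [h1, h3]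
    · filter_upwards [Lp.coeFn_add a.2 b.2, h2, h4] with x hx h2 h4
      rw [Prod.snd_add, hx]
      have e : fderiv ℝ (⇑φ + ⇑ψ) x = fderiv ℝ φ x + fderiv ℝ ψ x :=
        fderiv_add (φ.contDiff.differentiable (by simp) x) (ψ.contDiff.differentiable (by simp) x)
      ext p
      simp [jac, h2, h4, e]
  smul_mem' := by
    rintro c a ⟨φ, h1, h2⟩
    refine ⟨c • φ, ?_, ?_⟩
    · filter_upwards [Lp.coeFn_smul c a.1, h1] with x hx h1
      rw [Prod.smul_fst, hx]
      simp [h1]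
    · filter_upwards [Lp.coeFn_smul c a.2, h2] with x hx h2
      rw [Prod.smul_snd, hx]
      have e : fderiv ℝ (c • ⇑φ) x = c • fderiv ℝ φ x :=
        fderiv_const_smul (φ.contDiff.differentiable (by simp) x) c
      ext p
      simp [jac, h2, e]

/-- `H¹₀(Ω)²`, the closure of the test functions in `H¹(Ω)²`; an element is given as the pair
`(v, ∇v)`. -/
def H10 (Ω : Opens Plane) : Submodule ℝ (L2vec Ω × L2mat Ω) := (testGraph Ω).topologicalClosure

/-- The pairs `(v, ∇v)` with `v ∈ H¹₀(Ω)²` and `∇ · v = 0`. -/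
def divFree (Ω : Opens Plane) : Submodule ℝ (L2vec Ω × L2mat Ω) where
  carrier := {p | p ∈ H10 Ω ∧ ∀ᵐ x ∂volume.restrict (Ω : Set Plane), tr (p.2 x) = 0}
  zero_mem' := by
    refine ⟨zero_mem _, ?_⟩
    filter_upwards [Lp.coeFn_zero Mat 2 (volume.restrict (Ω : Set Plane))] with x hx
    rw [Prod.snd_zero, hx]
    simp [tr]
  add_mem' := by
    rintro a b ⟨ha, h1⟩ ⟨hb, h2⟩
    refine ⟨add_mem ha hb, ?_⟩
    filter_upwards [Lp.coeFn_add a.2 b.2, h1, h2] with x hx h1 h2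
    rw [Prod.snd_add, hx]
    simp only [tr, Pi.add_apply, PiLp.add_apply] at h1 h2 ⊢
    linarith
  smul_mem' := by
    rintro c a ⟨ha, h1⟩
    refine ⟨Submodule.smul_mem _ c ha, ?_⟩
    filter_upwards [Lp.coeFn_smul c a.2, h1] with x hx h1
    rw [Prod.smul_snd, hx]
    simp only [tr, Pi.smul_apply, PiLp.smul_apply, smul_eq_mul] at h1 ⊢
    rw [← mul_add, h1, mul_zero]

/-- The space `V = {v ∈ H¹₀(Ω)², ∇ · v = 0}`, normed below by `‖v‖ = ‖∇v‖` in `L²(Ω)`. -/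
def V (Ω : Opens Plane) : Type := divFree Ω

instance (Ω : Opens Plane) : AddCommGroup (V Ω) := inferInstanceAs (AddCommGroup (divFree Ω))

instance (Ω : Opens Plane) : Module ℝ (V Ω) := inferInstanceAs (Module ℝ (divFree Ω))

/-- The inclusion of `V` in `L²(Ω)²`. -/
def V.toL2 {Ω : Opens Plane} : V Ω →ₗ[ℝ] L2vec Ω :=
  LinearMap.fst ℝ (L2vec Ω) (L2mat Ω) ∘ₗ (divFree Ω).subtype

/-- The gradient `v ↦ ∇v` on `V`. -/
def V.grad {Ω : Opens Plane} : V Ω →ₗ[ℝ] L2mat Ω :=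
  LinearMap.snd ℝ (L2vec Ω) (L2mat Ω) ∘ₗ (divFree Ω).subtype

theorem norm_fderiv_le (φ : Plane → Plane) (x : Plane) : ‖fderiv ℝ φ x‖ ≤ 2 * ‖jac φ x‖ := by
  refine ContinuousLinearMap.opNorm_le_bound _ (by positivity) fun w => ?_
  have h1 : ∀ j, ‖fderiv ℝ φ x (EuclideanSpace.single j 1)‖ ≤ ‖jac φ x‖ := by
    intro j
    refine le_of_sq_le_sq ?_ (norm_nonneg _)
    rw [EuclideanSpace.norm_sq_eq, EuclideanSpace.norm_sq_eq, Fintype.sum_prod_type]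
    refine Finset.sum_le_sum fun i _ => ?_
    exact Finset.single_le_sum (f := fun j => ‖jac φ x (i, j)‖ ^ 2)
      (fun _ _ => by positivity) (Finset.mem_univ j)
  have h2 : w = ∑ j, w j • EuclideanSpace.single j (1 : ℝ) := by
    ext i
    fin_cases i <;> simp
  calc ‖fderiv ℝ φ x w‖ = ‖∑ j, w j • fderiv ℝ φ x (EuclideanSpace.single j 1)‖ := by
        conv_lhs => rw [h2]
        simp only [map_sum, map_smul]
    _ ≤ ∑ j : Fin 2, ‖w‖ * ‖jac φ x‖ := by
        refine (norm_sum_le _ _).trans (Finset.sum_le_sum fun j _ => ?_)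
        rw [norm_smul]
        exact mul_le_mul (PiLp.norm_apply_le w j) (h1 j) (norm_nonneg _) (norm_nonneg _)
    _ = 2 * ‖jac φ x‖ * ‖w‖ := by
        simp
        ring

theorem continuous_jac {φ : Plane → Plane} (h : ContDiff ℝ 1 φ) : Continuous (jac φ) := by
  have := h.continuous_fderiv one_ne_zero
  unfold jac
  fun_prop

/-- A form of the Gagliardo–Nirenberg inequality, which shows that the norm of `V` is definite. -/
theorem eLpNorm_testGraph_le {Ω : Opens Plane} : ∃ C : NNReal, ∀ p ∈ testGraph Ω,
    eLpNorm (fun x => ‖p.1 x‖ ^ 2) 2 (volume.restrict (Ω : Set Plane)) ≤ C * (‖p.1‖ₑ * ‖p.2‖ₑ) := by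
  refine ⟨eLpNormLESNormFDerivOneConst (volume : Measure Plane) 2 * 4, ?_⟩
  rintro p ⟨φ, h1, h2⟩
  have hφ : ContDiff ℝ 1 φ := φ.contDiff.of_le (by simp)
  have hu : ContDiff ℝ 1 fun x => ‖φ x‖ ^ 2 := hφ.norm_sq ℝ
  have hcs : HasCompactSupport fun x => ‖φ x‖ ^ 2 :=
    φ.hasCompactSupport.comp_left (g := fun y : Plane => ‖y‖ ^ 2) (by simp)
  have hp : NNReal.HolderConjugate (Module.finrank ℝ Plane) 2 := by
    rw [finrank_euclideanSpace_fin, NNReal.holderConjugate_iff]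
    constructor
    · norm_num
    · rw [Nat.cast_ofNat, ← NNReal.coe_inj]
      norm_num
  have key := eLpNorm_le_eLpNorm_fderiv_one (volume : Measure Plane) hu hcs hp
  have hs1 : Function.support φ ⊆ (Ω : Set Plane) :=
    (subset_tsupport _).trans φ.tsupport_subset
  have hs2 : Function.support (jac φ) ⊆ (Ω : Set Plane) := by
    intro x hx
    apply φ.tsupport_subset
    apply support_fderiv_subset ℝ
    intro h0
    apply hx
    ext q
    simp [jac, h0]
  have e1 : ‖p.1‖ₑ = eLpNorm φ 2 volume := by
    rw [Lp.enorm_def, eLpNorm_congr_ae h1, eLpNorm_restrict_eq_of_support_subset hs1]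
  have e2 : ‖p.2‖ₑ = eLpNorm (jac φ) 2 volume := by
    rw [Lp.enorm_def, eLpNorm_congr_ae h2, eLpNorm_restrict_eq_of_support_subset hs2]
  have e3 : eLpNorm (fun x => ‖p.1 x‖ ^ 2) 2 (volume.restrict (Ω : Set Plane)) ≤
      eLpNorm (fun x => ‖φ x‖ ^ 2) 2 volume := by
    refine le_trans (le_of_eq (eLpNorm_congr_ae ?_)) (eLpNorm_restrict_le _ _ _ _)
    filter_upwards [h1] with x hx
    rw [hx]
  have e4 : eLpNorm (fderiv ℝ fun x => ‖φ x‖ ^ 2) 1 volume ≤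
      4 * (eLpNorm φ 2 volume * eLpNorm (jac φ) 2 volume) := by
    have := eLpNorm_le_eLpNorm_mul_eLpNorm_of_nnnorm (μ := (volume : Measure Plane)) (p := 2)
      (q := 2) (r := 1) (f := φ) (g := jac φ) hφ.continuous.aestronglyMeasurable
      (continuous_jac hφ).aestronglyMeasurable (fun a b => 4 * (‖a‖ * ‖b‖)) 4
      (Eventually.of_forall fun x => by
        rw [← NNReal.coe_le_coe]
        simp [mul_assoc])
    refine le_trans (eLpNorm_mono fun x => ?_) (this.trans_eq ?_)
    · have hd : HasFDerivAt φ (fderiv ℝ φ x) x :=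
        (hφ.differentiable one_ne_zero x).hasFDerivAt
      rw [hd.norm_sq.fderiv]
      have : ‖(innerSL ℝ (φ x)).comp (fderiv ℝ φ x)‖ ≤ ‖φ x‖ * (2 * ‖jac φ x‖) := by
        refine (ContinuousLinearMap.opNorm_comp_le _ _).trans ?_
        rw [innerSL_apply_norm]
        exact mul_le_mul_of_nonneg_left (norm_fderiv_le _ _) (norm_nonneg _)
      rw [two_smul]
      refine (norm_add_le _ _).trans ?_
      simp only [norm_mul, norm_norm, Real.norm_ofNat]
      linarith
    · simp [mul_assoc]
  calc _ ≤ _ := e3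
    _ ≤ _ := key
    _ ≤ _ := mul_le_mul_right e4 _
    _ = _ := by
        rw [e1, e2, ENNReal.coe_mul, mul_assoc]
        rfl

theorem H10_injective {Ω : Opens Plane} {v : L2vec Ω} (h : (v, (0 : L2mat Ω)) ∈ H10 Ω) :
    v = 0 := by
  obtain ⟨p, hp, hlim⟩ := mem_closure_iff_seq_limit.1 h
  obtain ⟨C, hC⟩ := eLpNorm_testGraph_le (Ω := Ω)
  have l1 : Tendsto (fun n => (p n).1) atTop (𝓝 v) := (continuous_fst.tendsto _).comp hlim
  have l2 : Tendsto (fun n => (p n).2) atTop (𝓝 0) := (continuous_snd.tendsto _).comp hlim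
  have l3 : Tendsto (fun n => (C : ℝ≥0∞) * (‖(p n).1‖ₑ * ‖(p n).2‖ₑ)) atTop (𝓝 0) := by
    have := ENNReal.Tendsto.mul l1.enorm (Or.inr (by simp)) l2.enorm (Or.inr (by simp))
    have := ENNReal.Tendsto.const_mul (a := (C : ℝ≥0∞)) this (Or.inr (by simp))
    simpa using this
  have l4 := tendsto_of_tendsto_of_tendsto_of_le_of_le tendsto_const_nhds l3
    (fun n => zero_le) (fun n => hC (p n) (hp n))
  have m1 := tendstoInMeasure_of_tendsto_Lp l1
  obtain ⟨k, hk, a1⟩ := m1.exists_seq_tendsto_ae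
  have m2 : TendstoInMeasure (volume.restrict (Ω : Set Plane))
      (fun n x => ‖(p (k n)).1 x‖ ^ 2) atTop (fun _ => (0 : ℝ)) := by
    refine tendstoInMeasure_of_tendsto_eLpNorm (p := 2) (by simp) ?_ ?_ ?_
    · exact fun n => ((Lp.aestronglyMeasurable (p (k n)).1).norm.pow 2)
    · exact aestronglyMeasurable_const
    · refine (l4.comp hk.tendsto_atTop).congr fun n => ?_
      simp only [Function.comp]
      congr 1
      ext x
      simp
  obtain ⟨k', hk', a2⟩ := m2.exists_seq_tendsto_ae
  rw [Lp.eq_zero_iff_ae_eq_zero]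
  filter_upwards [a1, a2] with x h1 h2
  have h3 := ((h1.comp hk'.tendsto_atTop).norm.pow 2)
  have := tendsto_nhds_unique h3 h2
  simpa using this

theorem V.toL2_mem_H {Ω : Opens Plane} (v : V Ω) : V.toL2 v ∈ H Ω := by
  intro q r hqr
  let I : Mat := WithLp.toLp 2 fun p => if p.1 = p.2 then 1 else 0
  let Q : L2mat Ω := ((ContinuousLinearMap.id ℝ ℝ).smulRight I).compLp q
  have hQ : ∀ G : L2mat Ω, ⟪Q, G⟫ = ∫ x in (Ω : Set Plane), q x * tr (G x) := by
    intro G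
    rw [L2.inner_def]
    refine integral_congr_ae ?_
    filter_upwards [((ContinuousLinearMap.id ℝ ℝ).smulRight I).coeFn_compLp q] with x hx
    rw [hx]
    simp [PiLp.inner_apply, Fintype.sum_prod_type, I, tr]
    ring
  have hz : ∀ p ∈ H10 Ω, ⟪p.1, r⟫ + ⟪Q, p.2⟫ = 0 := by
    have hcl : IsClosed {p : L2vec Ω × L2mat Ω | ⟪p.1, r⟫ + ⟪Q, p.2⟫ = 0} :=
      isClosed_eq (by fun_prop) continuous_const
    intro p hp
    have hp' : p ∈ closure (testGraph Ω : Set (L2vec Ω × L2mat Ω)) := hp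
    refine closure_minimal ?_ hcl hp'
    rintro a ⟨φ, h1, h2⟩
    have e1 : ⟪a.1, r⟫ = ∫ x in (Ω : Set Plane), ⟪r x, φ x⟫ := by
      rw [L2.inner_def]
      refine integral_congr_ae ?_
      filter_upwards [h1] with x hx
      rw [hx, real_inner_comm]
    have e2 : ⟪Q, a.2⟫ = ∫ x in (Ω : Set Plane), q x * tr (jac φ x) := by
      rw [hQ]
      refine integral_congr_ae ?_
      filter_upwards [h2] with x hx
      rw [hx]
    change ⟪a.1, r⟫ + ⟪Q, a.2⟫ = 0
    rw [e1, e2, hqr φ]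
    ring
  have h0 : ⟪Q, v.1.2⟫ = 0 := by
    rw [hQ]
    refine integral_eq_zero_of_ae ?_
    filter_upwards [v.2.2] with x hx
    simp [hx]
  have := hz v.1 v.2.1
  rw [h0, add_zero] at this
  exact this

theorem V.grad_injective {Ω : Opens Plane} : Function.Injective (V.grad (Ω := Ω)) := by
  rw [← LinearMap.ker_eq_bot, LinearMap.ker_eq_bot']
  intro v hv
  have h2 : v.1.2 = 0 := hv
  have h1 : v.1.1 = 0 := by
    apply H10_injective (Ω := Ω)
    rw [← h2]
    exact v.2.1
  exact Subtype.ext (Prod.ext h1 h2)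

instance (Ω : Opens Plane) : NormedAddCommGroup (V Ω) :=
  NormedAddCommGroup.induced (V Ω) (L2mat Ω) V.grad V.grad_injective

/-- The inner product `(v, w) ↦ ∫ ∇v : ∇w` of `V`; its norm is `‖v‖ = ‖∇v‖`. -/
instance (Ω : Opens Plane) : InnerProductSpace ℝ (V Ω) where
  norm_smul_le c v := by
    change ‖V.grad (c • v)‖ ≤ ‖c‖ * ‖V.grad v‖
    rw [map_smul, norm_smul]
  inner v w := ⟪V.grad v, V.grad w⟫
  norm_sq_eq_re_inner v := norm_sq_eq_re_inner (𝕜 := ℝ) (V.grad v)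
  conj_inner_symm v w := inner_conj_symm (𝕜 := ℝ) (V.grad v) (V.grad w)
  add_left u v w := by rw [map_add, inner_add_left]
  smul_left v w c := by rw [map_smul, inner_smul_left]

/-- The inclusion of `V` in `H`. -/
def V.toH {Ω : Opens Plane} : V Ω →ₗ[ℝ] H Ω := V.toL2.codRestrict (H Ω) V.toL2_mem_H

/-- The dual space `V'` of the continuous linear functionals on `V`, with the dual norm. -/
def V' (Ω : Opens Plane) : Type := StrongDual ℝ (V Ω)

instance (Ω : Opens Plane) : NormedAddCommGroup (V' Ω) :=
  inferInstanceAs (NormedAddCommGroup (StrongDual ℝ (V Ω)))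

instance (Ω : Opens Plane) : NormedSpace ℝ (V' Ω) :=
  inferInstanceAs (NormedSpace ℝ (StrongDual ℝ (V Ω)))

/-- The duality bracket `⟨g, v⟩` is written `g v`. -/
instance (Ω : Opens Plane) : FunLike (V' Ω) (V Ω) ℝ :=
  inferInstanceAs (FunLike (StrongDual ℝ (V Ω)) (V Ω) ℝ)

/-- The strain tensor `Dv = (∇v + ∇vᵗ) / 2`. -/
def strain {Ω : Opens Plane} (v : V Ω) (x : Plane) : Mat := symPart (V.grad v x)

/-- The vector `(v · ∇) v` at `x`, with components `∑ j, vⱼ ∂ⱼ vᵢ`. -/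
def convect {Ω : Opens Plane} (v : V Ω) (x : Plane) : Plane :=
  WithLp.toLp 2 fun i => ∑ j, V.toL2 v x j * V.grad v x (i, j)

/-! ### The approximate problem -/

/-- The bi-viscosity tensor `τₘ`, with the threshold `γₘ = τ_y / (2 μ (m - 1))`. -/
def biviscosity (μ τy : ℝ) (m : ℕ) (A : Mat) : Mat :=
  if ‖A‖ ≤ τy / (2 * μ * ((m : ℝ) - 1)) then (2 * (m : ℝ) * μ) • A
  else (2 * μ + τy / ‖A‖) • A

/-- Lebesgue measure on the time interval `(0, T)`. -/
abbrev timeMeasure (T : ℝ) : Measure ℝ := volume.restrict (Ioo 0 T)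

/-- `g` is the weak time derivative on `(0, T)` of `u`, as a function with values in `V'`; `V` is
embedded in `V'` through the inner product of `H`. -/
def IsWeakTimeDeriv {Ω : Opens Plane} (T : ℝ) (u : ℝ → V Ω) (g : ℝ → V' Ω) : Prop :=
  ∀ η : ℝ → ℝ, ContDiff ℝ ∞ η → HasCompactSupport η → tsupport η ⊆ Ioo 0 T → ∀ w : V Ω,
    ∫ t in Ioo 0 T, deriv η t * ⟪V.toH (u t), V.toH w⟫ = -∫ t in Ioo 0 T, η t * g t w

/-- `u` solves the approximate problem with the stress tensor `τₘ`, the force `f` and the initial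
value `u₀`, and `g` is `∂ₜu`: both `u ∈ L²(0,T;V)` and `∂ₜu ∈ L²(0,T;V')`, the weak formulation
holds for all test functions in `L²(0,T;V)`, and `u` is (for almost all `t` equal to a function)
continuous from `[0,T]` to `H` with the value `u₀` at `t = 0`. -/
structure IsApproxSolution {Ω : Opens Plane} (T μ τy : ℝ) (f : ℝ → V' Ω) (u₀ : H Ω) (m : ℕ)
    (u : ℝ → V Ω) (g : ℝ → V' Ω) : Prop where
  memLp : MemLp u 2 (timeMeasure T)
  memLp_deriv : MemLp g 2 (timeMeasure T)
  deriv_eq : IsWeakTimeDeriv T u g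
  weak_form : ∀ φ : ℝ → V Ω, MemLp φ 2 (timeMeasure T) →
    (∫ t in Ioo 0 T, g t (φ t)) +
      (∫ t in Ioo 0 T, ∫ x in (Ω : Set Plane),
        ⟪biviscosity μ τy m (strain (u t) x), strain (φ t) x⟫) +
      (∫ t in Ioo 0 T, ∫ x in (Ω : Set Plane), ⟪convect (u t) x, V.toL2 (φ t) x⟫) =
    ∫ t in Ioo 0 T, f t (φ t)
  initial : ∃ U : ℝ → H Ω, ContinuousOn U (Icc 0 T) ∧ U 0 = u₀ ∧
    ∀ᵐ t ∂timeMeasure T, V.toH (u t) = U t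

end Bingham

end

noncomputable section

namespace Bingham

/-! ### Absolute continuity from the weak derivative -/

/-! The estimates come from pairing the equation with `u` itself. The convective term then vanishes
(`divDual_tensor_self`). The stress term dominates `2μ‖Du‖²`, because both branches of `τₘ` multiply
`A` by a factor at least `2μ` whatever `m` is. Korn's identity turns this into `μ‖∇u‖²` for
divergence-free fields that vanish on the boundary (`le_divDual_stress`).

The time term is handled by `energy_identity`, `‖U b‖² - ‖U 0‖² = 2 ∫ ⟨g, u⟩` over `(0, b)`. Young's
inequality absorbs the force, and `‖U b‖² + μ ∫ ‖u‖²` is bounded by `‖u₀‖² + ‖f‖² / μ`, which does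
not involve `m`.

The other bounds follow from this one. The threshold `γₘ` is chosen so that `|τₘ(A)| ≤ 2μ|A| + τ_y`
for every `m`, and finite area puts the constant `τ_y` in `L²`. The convective term equals `-div(u ⊗
u)`, and the Ladyzhenskaya inequality gives `‖u ⊗ u‖ ≤ c ‖u‖_H ‖u‖_V` in `L²(Ω)`, which is square
integrable in time. The equation, read in `V'` at almost every time (`equation_ae`), then bounds
`∂ₜu`. -/

theorem integral_deriv_smoothTransition : ∫ y in (0 : ℝ)..1, deriv Real.smoothTransition y = 1 := by
  rw [intervalIntegral.integral_deriv_eq_sub]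
  · simp [Real.smoothTransition.one_of_one_le, Real.smoothTransition.zero_of_nonpos]
  · intro x _
    exact (Real.smoothTransition.contDiff (n := 1)).differentiable one_ne_zero x
  · exact ((Real.smoothTransition.contDiff (n := 1)).continuous_deriv le_rfl).intervalIntegrable _ _

/-- A smooth step of width `ε` at `s`. -/
def smoothStep (s ε x : ℝ) : ℝ := Real.smoothTransition ((x - s) / ε)

theorem contDiff_smoothStep (s ε : ℝ) : ContDiff ℝ ∞ (smoothStep s ε) := by
  unfold smoothStep
  exact Real.smoothTransition.contDiff.comp ((contDiff_id.sub contDiff_const).div_const _)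

theorem smoothStep_of_le {s ε x : ℝ} (hε : 0 < ε) (h : x ≤ s) : smoothStep s ε x = 0 :=
  Real.smoothTransition.zero_of_nonpos (div_nonpos_of_nonpos_of_nonneg (by linarith) hε.le)

theorem smoothStep_of_ge {s ε x : ℝ} (hε : 0 < ε) (h : s + ε ≤ x) : smoothStep s ε x = 1 :=
  Real.smoothTransition.one_of_one_le ((one_le_div hε).2 (by linarith))

theorem deriv_smoothStep (s ε x : ℝ) :
    deriv (smoothStep s ε) x = deriv Real.smoothTransition ((x - s) / ε) * ε⁻¹ := by
  have h1 : HasDerivAt (fun x : ℝ => (x - s) / ε) ε⁻¹ x := by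
    simpa using ((hasDerivAt_id x).sub_const s).div_const ε
  have h2 := ((Real.smoothTransition.contDiff (n := 1)).differentiable one_ne_zero
    ((x - s) / ε)).hasDerivAt
  exact (h2.comp x h1).deriv

theorem deriv_smoothStep_eq_zero {s ε x : ℝ} (hε : 0 < ε) (h : x ∉ Icc s (s + ε)) :
    deriv (smoothStep s ε) x = 0 := by
  rcases not_and_or.1 h with h | h
  · have : smoothStep s ε =ᶠ[𝓝 x] fun _ => 0 := by
      filter_upwards [Iio_mem_nhds (not_le.1 h)] with y hy
      exact smoothStep_of_le hε (le_of_lt hy)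
    rw [this.deriv_eq, deriv_const]
  · have : smoothStep s ε =ᶠ[𝓝 x] fun _ => 1 := by
      filter_upwards [Ioi_mem_nhds (not_le.1 h)] with y hy
      exact smoothStep_of_ge hε (le_of_lt hy)
    rw [this.deriv_eq, deriv_const]

/-- The substitution `x = s + ε y` turns the derivative of the step into a fixed weight of mass one,
so that for continuous `F` the limit `ε → 0` is `F s`. -/
theorem setIntegral_deriv_smoothStep_mul {F : ℝ → ℝ} {T s ε : ℝ} (hs : 0 < s) (hε : 0 < ε)
    (hsT : s + ε < T) :
    ∫ x in Ioo 0 T, deriv (smoothStep s ε) x * F x =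
      ∫ y in (0 : ℝ)..1, deriv Real.smoothTransition y * F (s + ε * y) := by
  have h1 : ∫ x in Ioo 0 T, deriv (smoothStep s ε) x * F x =
      ∫ x in Icc s (s + ε), deriv (smoothStep s ε) x * F x := by
    refine setIntegral_eq_of_subset_of_forall_sdiff_eq_zero measurableSet_Ioo
      (fun x hx => ⟨hs.trans_le hx.1, hx.2.trans_lt hsT⟩) fun x hx => ?_
    rw [deriv_smoothStep_eq_zero hε hx.2, zero_mul]
  rw [h1, integral_Icc_eq_integral_Ioc, ← intervalIntegral.integral_of_le (by linarith)]
  have := intervalIntegral.integral_comp_mul_add (a := 0) (b := 1)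
    (fun x => deriv (smoothStep s ε) x * F x) hε.ne' s
  simp only [mul_zero, mul_one, zero_add, smul_eq_mul] at this
  rw [show s + ε = ε + s from add_comm _ _]
  rw [eq_comm, inv_mul_eq_iff_eq_mul₀ hε.ne'] at this
  rw [this, ← intervalIntegral.integral_const_mul]
  congr 1
  ext y
  rw [deriv_smoothStep]
  have : (ε * y + s - s) / ε = y := by field_simp; ring
  rw [this, add_comm s]
  field_simp

/-- A continuous function whose weak derivative is `G` is a primitive of `G`. -/
theorem sub_eq_integral_of_weak_deriv {T : ℝ} {F G : ℝ → ℝ} (hF : Continuous F)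
    (hG : IntegrableOn G (Ioo 0 T))
    (h : ∀ η : ℝ → ℝ, ContDiff ℝ ∞ η → HasCompactSupport η → tsupport η ⊆ Ioo 0 T →
      ∫ t in Ioo 0 T, deriv η t * F t = -∫ t in Ioo 0 T, η t * G t)
    {s t : ℝ} (hs : 0 < s) (hst : s ≤ t) (ht : t < T) :
    F t - F s = ∫ r in s..t, G r := by
  -- The denominator `n + 2` keeps `t + ε n` strictly below `T` already for `n = 0`.
  let ε : ℕ → ℝ := fun n => (T - t) / (n + 2)
  have hε : ∀ n, 0 < ε n := fun n => by
    have : 0 < T - t := by linarith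
    positivity
  have hεT : ∀ n, t + ε n < T := fun n => by
    have h1 : (T - t) / (n + 2) < T - t := by
      rw [div_lt_iff₀ (by positivity)]
      have : (0 : ℝ) ≤ n := n.cast_nonneg
      nlinarith
    change t + (T - t) / (n + 2) < T
    linarith
  have hε0 : Tendsto ε atTop (𝓝 0) := by
    have := (tendsto_natCast_atTop_atTop (R := ℝ)).atTop_add (tendsto_const_nhds (x := (2 : ℝ)))
    exact tendsto_const_nhds.div_atTop this
  -- The difference of two steps approximates the indicator of `(s, t]`, and its derivative
  -- concentrates at `s` and, with the opposite sign, at `t`.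
  let η : ℕ → ℝ → ℝ := fun n x => smoothStep s (ε n) x - smoothStep t (ε n) x
  have hη : ∀ n, ContDiff ℝ ∞ (η n) := fun n =>
    (contDiff_smoothStep _ _).sub (contDiff_smoothStep _ _)
  have hsupp : ∀ n, tsupport (η n) ⊆ Icc s (t + ε n) := by
    intro n
    refine closure_minimal ?_ isClosed_Icc
    intro x hx
    by_contra hx'
    apply hx
    rcases not_and_or.1 hx' with h' | h'
    · have h' := not_le.1 h'
      simp [η, smoothStep_of_le (hε n) h'.le, smoothStep_of_le (hε n) (h'.le.trans hst)]
    · have h' := (not_le.1 h').le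
      simp [η, smoothStep_of_ge (hε n) h',
        smoothStep_of_ge (hε n) ((add_le_add_left hst (ε n)).trans h')]
  have key : ∀ n, (∫ y in (0 : ℝ)..1, deriv Real.smoothTransition y * F (s + ε n * y)) -
      (∫ y in (0 : ℝ)..1, deriv Real.smoothTransition y * F (t + ε n * y)) =
      -∫ r in Ioo 0 T, η n r * G r := by
    intro n
    rw [← h (η n) (hη n) (HasCompactSupport.of_support_subset_isCompact isCompact_Icc
      ((subset_tsupport _).trans (hsupp n)))
      ((hsupp n).trans fun x hx => ⟨hs.trans_le hx.1, hx.2.trans_lt (hεT n)⟩),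
      ← setIntegral_deriv_smoothStep_mul hs (hε n) (by linarith [hεT n]),
      ← setIntegral_deriv_smoothStep_mul (by linarith) (hε n) (hεT n), ← integral_sub]
    · refine integral_congr_ae (Eventually.of_forall fun x => ?_)
      have : deriv (η n) x = deriv (smoothStep s (ε n)) x - deriv (smoothStep t (ε n)) x :=
        deriv_sub ((contDiff_smoothStep _ _).differentiable (by simp) x)
          ((contDiff_smoothStep _ _).differentiable (by simp) x)
      simp only [this]
      ring
    all_goals
      refine Continuous.integrableOn_Icc (a := 0) (b := T) ?_ |>.mono_set Ioo_subset_Icc_self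
      exact ((contDiff_smoothStep _ _).continuous_deriv (by simp)).mul hF
  have lim1 : ∀ a, Tendsto
      (fun n => ∫ y in (0 : ℝ)..1, deriv Real.smoothTransition y * F (a + ε n * y)) atTop
      (𝓝 (F a)) := by
    intro a
    have hc : Continuous fun e : ℝ =>
        ∫ y in (0 : ℝ)..1, deriv Real.smoothTransition y * F (a + e * y) := by
      apply intervalIntegral.continuous_parametric_intervalIntegral_of_continuous'
      have := (Real.smoothTransition.contDiff (n := 1)).continuous_deriv le_rfl
      unfold Function.uncurry
      fun_prop
    have := (hc.tendsto 0).comp hε0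
    simpa [intervalIntegral.integral_mul_const, integral_deriv_smoothTransition,
      Function.comp_def] using this
  have lim2 : Tendsto (fun n => ∫ r in Ioo 0 T, η n r * G r) atTop
      (𝓝 (∫ r in Ioo 0 T, (Ioc s t).indicator G r)) := by
    have hstep : ∀ a x, Tendsto (fun n => smoothStep a (ε n) x) atTop
        (𝓝 ((Ioi a).indicator 1 x)) := by
      intro a x
      rcases le_or_gt x a with hx | hx
      · have : ∀ n, smoothStep a (ε n) x = 0 := fun n => smoothStep_of_le (hε n) hx
        simp [this, hx]
      · have h1 : ∀ᶠ n in atTop, smoothStep a (ε n) x = 1 := by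
          filter_upwards [hε0.eventually_lt_const (sub_pos.2 hx)] with n hn
          exact smoothStep_of_ge (hε n) (by linarith)
        rw [indicator_of_mem (by exact hx)]
        exact tendsto_const_nhds.congr' (h1.mono fun n hn => hn.symm)
    refine tendsto_integral_of_dominated_convergence (fun x => 2 * ‖G x‖) ?_ ?_ ?_ ?_
    · intro n
      exact (hη n).continuous.aestronglyMeasurable.mul hG.aestronglyMeasurable
    · exact hG.norm.const_mul 2
    · intro n
      refine Eventually.of_forall fun x => ?_
      rw [norm_mul]
      refine mul_le_mul_of_nonneg_right ?_ (norm_nonneg _)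
      refine (norm_sub_le _ _).trans ?_
      have hb : ∀ a, ‖smoothStep a (ε n) x‖ ≤ 1 := fun a => by
        rw [smoothStep, Real.norm_of_nonneg (Real.smoothTransition.nonneg _)]
        exact Real.smoothTransition.le_one _
      linarith [hb s, hb t]
    · refine Eventually.of_forall fun x => ?_
      have := ((hstep s x).sub (hstep t x)).mul_const (G x)
      convert this using 2
      by_cases h1 : s < x <;> by_cases h2 : t < x <;> simp [indicator, h1, h2]
      exact absurd (hst.trans_lt h2) h1
  have e := tendsto_nhds_unique (((lim1 s).sub (lim1 t)).congr key) lim2.neg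
  rw [setIntegral_indicator measurableSet_Ioc, inter_eq_right.2,
    ← intervalIntegral.integral_of_le hst] at e
  · linarith
  · exact fun x hx => ⟨hs.trans hx.1, hx.2.trans_lt ht⟩

/-! ### The energy identity -/

section Energy

variable {E F : Type*} [NormedAddCommGroup E] [NormedSpace ℝ E]
  [NormedAddCommGroup F] [InnerProductSpace ℝ F]

theorem continuous_translate {G : Type*} [NormedAddCommGroup G] (f : Lp G 2 (volume : Measure ℝ)) :
    Continuous fun r : ℝ => DomAddAct.mk r +ᵥ f := by
  have : Fact ((2 : ℝ≥0∞) ≠ ⊤) := ⟨by simp⟩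
  exact DomAddAct.mkHomeomorph.continuous.vadd continuous_const

/-- Translations act continuously on `L²`, and the pairing from `L² × L²` to `L¹` is continuous.
This replaces continuity of `g` and `u` when the time increment tends to zero. -/
theorem continuous_integral_translate {g : ℝ → StrongDual ℝ E} {u : ℝ → E}
    (hg : MemLp g 2 volume) (hu : MemLp u 2 volume) (s : Set ℝ) :
    Continuous fun p : ℝ × ℝ => ∫ t in s, g (t + p.1) (u (t + p.2) + u t) := by
  let P := (ContinuousLinearMap.id ℝ (StrongDual ℝ E)).holderL (volume : Measure ℝ) 2 2 1
  have h1 : Continuous fun p : ℝ × ℝ =>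
      P (DomAddAct.mk p.1 +ᵥ hg.toLp g) ((DomAddAct.mk p.2 +ᵥ hu.toLp u) + hu.toLp u) := by
    have hg' := (continuous_translate (hg.toLp g)).comp (continuous_fst (X := ℝ) (Y := ℝ))
    have hu' := (continuous_translate (hu.toLp u)).comp (continuous_snd (X := ℝ) (Y := ℝ))
    exact (P.continuous.comp hg').clm_apply (hu'.add continuous_const)
  refine ((continuous_setIntegral s).comp h1).congr fun p => ?_
  refine integral_congr_ae (ae_restrict_of_ae ?_)
  have a1 := (ContinuousLinearMap.id ℝ (StrongDual ℝ E)).coeFn_holder (r := 1)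
    (DomAddAct.mk p.1 +ᵥ hg.toLp g) ((DomAddAct.mk p.2 +ᵥ hu.toLp u) + hu.toLp u)
  have a2 := Lp.coeFn_add (DomAddAct.mk p.2 +ᵥ hu.toLp u) (hu.toLp u)
  have a3 := DomAddAct.vadd_Lp_ae_eq (DomAddAct.mk p.1) (hg.toLp g)
  have a4 := DomAddAct.vadd_Lp_ae_eq (DomAddAct.mk p.2) (hu.toLp u)
  have q : ∀ r : ℝ, Measure.QuasiMeasurePreserving (fun t : ℝ => r + t) volume volume :=
    fun r => (measurePreserving_add_left volume r).quasiMeasurePreserving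
  filter_upwards [a1, a2, a3, a4, (q p.1).ae hg.coeFn_toLp, (q p.2).ae hu.coeFn_toLp,
    hu.coeFn_toLp] with t b1 b2 b3 b4 b5 b6 b7
  change ((ContinuousLinearMap.id ℝ (StrongDual ℝ E)).holder (r := 1) _ _ : ℝ → ℝ) t = _
  rw [b1, b2, Pi.add_apply, b3, b4, b7]
  simp only [ContinuousLinearMap.id_apply, vadd_eq_add,
    Equiv.symm_apply_apply, b5, b6]
  rw [add_comm t, add_comm t]

/-- This justifies Fubini in the energy identity; the integrand is dominated by the sum of the two
squared norms. -/
theorem integrable_translate_prod {g : ℝ → StrongDual ℝ E} {v : ℝ → E}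
    (hgm : StronglyMeasurable g) (hg : MemLp g 2 volume)
    (hvm : StronglyMeasurable v) (hv : MemLp v 2 volume) (b h : ℝ) :
    Integrable (Function.uncurry fun t y : ℝ => g (t + h * y) (v t))
      ((volume.restrict (Ioo 0 b)).prod (volume.restrict (Ioc (0 : ℝ) 1))) := by
  have hm1 : StronglyMeasurable fun p : ℝ × ℝ => g (p.1 + h * p.2) :=
    hgm.comp_measurable (by fun_prop)
  have hm2 : StronglyMeasurable fun p : ℝ × ℝ => v p.1 := hvm.comp_measurable measurable_fst
  have i1 : Integrable (fun p : ℝ × ℝ => ‖g (p.1 + h * p.2)‖ ^ 2)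
      ((volume.restrict (Ioo 0 b)).prod (volume.restrict (Ioc (0 : ℝ) 1))) := by
    have hi : Integrable (fun t => ‖g t‖ ^ 2) volume := hg.integrable_norm_pow (by simp)
    refine (integrable_prod_iff' (hm1.norm.pow 2).aestronglyMeasurable).2 ⟨?_, ?_⟩
    · exact Eventually.of_forall fun y => (hi.comp_add_right (h * y)).integrableOn
    · refine Integrable.mono' (g := fun _ => ∫ t, ‖g t‖ ^ 2) (integrable_const _) ?_ ?_
      · exact ((hm1.norm.pow 2).norm.integral_prod_left').aestronglyMeasurable
      · refine Eventually.of_forall fun y => ?_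
        rw [Real.norm_of_nonneg (integral_nonneg fun _ => norm_nonneg _)]
        simp only [Pi.pow_apply, norm_pow, norm_norm]
        refine (setIntegral_le_integral (hi.comp_add_right (h * y))
          (Eventually.of_forall fun _ => by positivity)).trans_eq ?_
        exact integral_add_right_eq_self (fun t => ‖g t‖ ^ 2) (h * y)
  have hv2 : Integrable (fun t => ‖v t‖ ^ 2) volume := hv.integrable_norm_pow (by simp)
  have i2 : Integrable (fun p : ℝ × ℝ => ‖v p.1‖ ^ 2)
      ((volume.restrict (Ioo 0 b)).prod (volume.restrict (Ioc (0 : ℝ) 1))) :=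
    Integrable.comp_fst (f := fun t => ‖v t‖ ^ 2) hv2.integrableOn _
  refine (i1.add i2).mono' ?_ (Eventually.of_forall fun p => ?_)
  · exact (isBoundedBilinearMap_apply.continuous.comp_stronglyMeasurable
      (hm1.prodMk hm2)).aestronglyMeasurable
  · refine ((g (p.1 + h * p.2)).le_opNorm (v p.1)).trans ?_
    simp only [Pi.add_apply]
    nlinarith [sq_nonneg (‖g (p.1 + h * p.2)‖ - ‖v p.1‖), sq_nonneg ‖g (p.1 + h * p.2)‖,
      sq_nonneg ‖v p.1‖]

/-- The polarization `‖U(t+h)‖² - ‖U(t)‖² = ⟪U(t+h) - U(t), U(t+h) + U(t)⟫`, with `w = u(t+h) +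
u(t)` in `hprim`, gives the integral of `g` over `(t, t+h)` applied to `w`. Integrating in `t` over
`(0, b)`, dividing by `h` and letting `h → 0` gives the claim. Continuity of `i` plays no role. -/
theorem energy_identity_of_primitive {T b : ℝ} {i : E →ₗ[ℝ] F} {g : ℝ → StrongDual ℝ E}
    {u : ℝ → E} {U : ℝ → F} (hgm : StronglyMeasurable g) (hg : MemLp g 2 volume)
    (hum : StronglyMeasurable u) (hu : MemLp u 2 volume) (hU : Continuous U)
    (huU : ∀ᵐ t ∂volume.restrict (Ioo 0 T), i (u t) = U t)
    (hprim : ∀ w s t, 0 < s → s ≤ t → t < T → ⟪U t - U s, i w⟫ = ∫ r in s..t, g r w)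
    (hb : 0 < b) (hbT : b < T) :
    ‖U b‖ ^ 2 - ‖U 0‖ ^ 2 = 2 * ∫ t in Ioo 0 b, g t (u t) := by
  have hN : Continuous fun t => ‖U t‖ ^ 2 := hU.norm.pow 2
  have huU' := ae_imp_of_ae_restrict huU
  have step : ∀ h, 0 < h → h < T - b → ∀ᵐ t ∂volume.restrict (Ioo 0 b),
      ‖U (t + h)‖ ^ 2 - ‖U t‖ ^ 2 = h * ∫ y in Ioc (0 : ℝ) 1, g (t + h * y) (u (t + h) + u t) := by
    intro h h0 h1
    rw [ae_restrict_iff' measurableSet_Ioo]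
    filter_upwards [huU',
      (measurePreserving_add_right volume h).quasiMeasurePreserving.ae huU'] with t a1 a2 ht
    have e1 := a1 ⟨ht.1, ht.2.trans hbT⟩
    have e2 := a2 ⟨by linarith [ht.1], by linarith [ht.2]⟩
    have e3 := hprim (u (t + h) + u t) t (t + h) ht.1 (by linarith) (by linarith [ht.2])
    rw [map_add, e1, e2] at e3
    have e4 := intervalIntegral.integral_comp_mul_add (a := 0) (b := 1)
      (fun r => g r (u (t + h) + u t)) h0.ne' t
    simp only [mul_zero, mul_one, zero_add, smul_eq_mul] at e4
    rw [add_comm h t, ← e3, eq_inv_mul_iff_mul_eq₀ h0.ne'] at e4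
    rw [← intervalIntegral.integral_of_le zero_le_one]
    simp_rw [add_comm t (h * _)]
    rw [e4, inner_sub_left, inner_add_right, inner_add_right, real_inner_self_eq_norm_sq,
      real_inner_self_eq_norm_sq, real_inner_comm (U t) (U (t + h))]
    ring
  -- After integration in `t` the left side telescopes to the end pieces `(b, b + h)` and `(0, h)`.
  have ident : ∀ h, 0 < h → h < T - b →
      h⁻¹ * ((∫ t in (0 : ℝ)..(b + h), ‖U t‖ ^ 2) - (∫ t in (0 : ℝ)..b, ‖U t‖ ^ 2)) -
        h⁻¹ * (∫ t in (0 : ℝ)..h, ‖U t‖ ^ 2) =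
      ∫ y in (0 : ℝ)..1, ∫ t in Ioo 0 b, g (t + h * y) (u (t + h) + u t) := by
    intro h h0 h1
    have e1 : ∫ t in Ioo 0 b, (‖U (t + h)‖ ^ 2 - ‖U t‖ ^ 2) =
        h * ∫ y in (0 : ℝ)..1, ∫ t in Ioo 0 b, g (t + h * y) (u (t + h) + u t) := by
      rw [integral_congr_ae (step h h0 h1), integral_const_mul, integral_integral_swap,
        intervalIntegral.integral_of_le zero_le_one]
      exact integrable_translate_prod hgm hg
        ((hum.comp_measurable (measurable_add_const h)).add hum)
        ((hu.comp_measurePreserving (measurePreserving_add_right volume h)).add hu) b h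
    rw [← integral_Ioc_eq_integral_Ioo, ← intervalIntegral.integral_of_le hb.le,
      intervalIntegral.integral_sub
        (by apply Continuous.intervalIntegrable; fun_prop) (hN.intervalIntegrable _ _),
      intervalIntegral.integral_comp_add_right (fun t => ‖U t‖ ^ 2), zero_add] at e1
    have e2 := intervalIntegral.integral_add_adjacent_intervals
      (hN.intervalIntegrable (μ := volume) 0 h) (hN.intervalIntegrable h (b + h))
    rw [← mul_right_inj' h0.ne', ← e1]
    field_simp
    linarith
  have hderiv : ∀ a, HasDerivAt (fun x => ∫ t in (0 : ℝ)..x, ‖U t‖ ^ 2) (‖U a‖ ^ 2) a := fun a =>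
    intervalIntegral.integral_hasDerivAt_right (hN.intervalIntegrable _ _)
      (hN.stronglyMeasurableAtFilter _ _) hN.continuousAt
  have hslope : ∀ a, Tendsto (fun h => h⁻¹ * ((∫ t in (0 : ℝ)..(a + h), ‖U t‖ ^ 2) -
      (∫ t in (0 : ℝ)..a, ‖U t‖ ^ 2))) (𝓝[>] 0) (𝓝 (‖U a‖ ^ 2)) := fun a => by
    simpa using (hderiv a).tendsto_slope_zero_right
  have lim1 := (hslope b).sub (hslope 0)
  simp only [zero_add, intervalIntegral.integral_same, sub_zero] at lim1
  -- With the time increment rescaled to `y ∈ (0, 1)`, the limit is the value at `h = 0` of a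
  -- continuous function.
  have hc : Continuous fun h : ℝ =>
      ∫ y in (0 : ℝ)..1, ∫ t in Ioo 0 b, g (t + h * y) (u (t + h) + u t) := by
    apply intervalIntegral.continuous_parametric_intervalIntegral_of_continuous'
    exact (continuous_integral_translate hg hu (Ioo 0 b)).comp
      (g := fun p : ℝ × ℝ => ∫ t in Ioo 0 b, g (t + p.1) (u (t + p.2) + u t))
      (f := fun p : ℝ × ℝ => (p.1 * p.2, p.1)) (by fun_prop)
  have lim2 := (hc.tendsto 0).mono_left (nhdsWithin_le_nhds (s := Ioi 0))
  have hev : ∀ᶠ h : ℝ in 𝓝[>] 0, 0 < h ∧ h < T - b :=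
    Ioo_mem_nhdsGT (sub_pos.2 hbT)
  have := tendsto_nhds_unique (lim1.congr' (hev.mono fun h hh => ident h hh.1 hh.2)) lim2
  rw [this]
  simp only [zero_mul, add_zero, map_add, intervalIntegral.integral_const, sub_zero, one_smul]
  rw [← integral_const_mul]
  congr 1
  ext t
  ring

end Energy

section EnergyIdentity

variable {E F : Type*} [NormedAddCommGroup E] [NormedSpace ℝ E]
  [NormedAddCommGroup F] [InnerProductSpace ℝ F]

/-- Extension by zero makes time translations available on the whole line. -/
theorem exists_stronglyMeasurable_extension {α G : Type*} [MeasurableSpace α] {μ : Measure α}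
    [NormedAddCommGroup G] {s : Set α} (hs : MeasurableSet s) {f : α → G} {p : ℝ≥0∞}
    (hf : MemLp f p (μ.restrict s)) :
    ∃ f' : α → G, StronglyMeasurable f' ∧ MemLp f' p μ ∧ ∀ᵐ t ∂μ.restrict s, f t = f' t := by
  refine ⟨s.indicator (hf.1.mk f), hf.1.stronglyMeasurable_mk.indicator hs,
    (memLp_indicator_iff_restrict hs).2 ((memLp_congr_ae hf.1.ae_eq_mk).1 hf), ?_⟩
  filter_upwards [hf.1.ae_eq_mk, ae_restrict_mem hs] with t h1 h2
  rw [indicator_of_mem h2, h1]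

/-- If `u ∈ L²(0,T;E)` has the weak derivative `g ∈ L²(0,T;E')` with respect to the inner product
of `F`, and `U` is its continuous representative, then `d/dt ‖U‖² = 2 ⟨g, u⟩`. -/
theorem energy_identity {T b : ℝ} {i : E →ₗ[ℝ] F} {g : ℝ → StrongDual ℝ E}
    {u : ℝ → E} {U : ℝ → F} (hg : MemLp g 2 (volume.restrict (Ioo 0 T)))
    (hu : MemLp u 2 (volume.restrict (Ioo 0 T))) (hU : ContinuousOn U (Icc 0 T))
    (huU : ∀ᵐ t ∂volume.restrict (Ioo 0 T), i (u t) = U t)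
    (hd : ∀ η : ℝ → ℝ, ContDiff ℝ ∞ η → HasCompactSupport η → tsupport η ⊆ Ioo 0 T → ∀ w : E,
      ∫ t in Ioo 0 T, deriv η t * ⟪i (u t), i w⟫ = -∫ t in Ioo 0 T, η t * g t w)
    (hb : 0 < b) (hbT : b < T) :
    ‖U b‖ ^ 2 - ‖U 0‖ ^ 2 = 2 * ∫ t in Ioo 0 b, g t (u t) := by
  have hT : 0 ≤ T := (hb.trans hbT).le
  have hsub : Ioo 0 b ⊆ Ioo 0 T := Ioo_subset_Ioo_right hbT.le
  obtain ⟨g', hgm, hg', eg⟩ := exists_stronglyMeasurable_extension measurableSet_Ioo hg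
  obtain ⟨u', hum, hu', eu⟩ := exists_stronglyMeasurable_extension measurableSet_Ioo hu
  -- Unlike `g` and `u`, the function `U` is extended by its end values, to remain continuous.
  obtain ⟨U', hU'c, hU'⟩ : ∃ U' : ℝ → F, Continuous U' ∧ ∀ t ∈ Icc 0 T, U' t = U t :=
    ⟨IccExtend hT ((Icc 0 T).domRestrict U),
      (continuousOn_iff_continuous_domRestrict.1 hU).Icc_extend',
      fun t ht => by rw [IccExtend_of_mem hT _ ht]; rfl⟩
  have huU' : ∀ᵐ t ∂volume.restrict (Ioo 0 T), i (u' t) = U' t := by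
    filter_upwards [eu, huU, ae_restrict_mem measurableSet_Ioo] with t h1 h2 h3
    rw [← h1, h2, hU' t (Ioo_subset_Icc_self h3)]
  have key := energy_identity_of_primitive (T := T) (b := b) hgm hg' hum hu' hU'c huU' ?_ hb hbT
  · rw [hU' b ⟨hb.le, hbT.le⟩, hU' 0 ⟨le_rfl, hT⟩] at key
    rw [key]
    congr 1
    refine integral_congr_ae ?_
    filter_upwards [ae_restrict_of_ae_restrict_of_subset hsub eg,
      ae_restrict_of_ae_restrict_of_subset hsub eu] with t h1 h2
    rw [h1, h2]
  · intro w s t hs hst ht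
    have hgw : MemLp (fun r => g r w) 2 (volume.restrict (Ioo 0 T)) :=
      (ContinuousLinearMap.apply ℝ ℝ w).comp_memLp' hg
    have := sub_eq_integral_of_weak_deriv (T := T) (F := fun t => ⟪U' t, i w⟫)
      (G := fun r => g r w) (by fun_prop) (hgw.integrable one_le_two) ?_ hs hst ht
    · rw [inner_sub_left, this, intervalIntegral.integral_of_le hst,
        intervalIntegral.integral_of_le hst]
      refine integral_congr_ae ?_
      filter_upwards [ae_restrict_of_ae_restrict_of_subset
        (show Ioc s t ⊆ Ioo 0 T from fun x hx => ⟨hs.trans hx.1, hx.2.trans_lt ht⟩) eg] with r h1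
      rw [h1]
    · intro η h1 h2 h3
      rw [← hd η h1 h2 h3 w]
      refine integral_congr_ae ?_
      filter_upwards [huU', eu] with t h1 h2
      rw [← h1, h2]

/-- A functional on `L²(E)` given by a function with values in `E'` determines this function. -/
theorem ae_eq_zero_of_forall_integral_apply_eq_zero {α : Type*} [MeasurableSpace α]
    {μ : Measure α} [IsFiniteMeasure μ] [SeparableSpace E] {R : α → StrongDual ℝ E}
    (hR : MemLp R 2 μ) (h : ∀ φ : α → E, MemLp φ 2 μ → ∫ t, R t (φ t) ∂μ = 0) :
    ∀ᵐ t ∂μ, R t = 0 := by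
  have h1 : ∀ w : E, ∀ᵐ t ∂μ, R t w = 0 := by
    intro w
    have hRw : MemLp (fun r => R r w) 2 μ := (ContinuousLinearMap.apply ℝ ℝ w).comp_memLp' hR
    refine ae_eq_zero_of_forall_setIntegral_eq_of_sigmaFinite (f := fun t => R t w)
      (fun s _ _ => (hRw.integrable one_le_two).integrableOn) fun s hs _ => ?_
    rw [← h (s.indicator fun _ => w) ((memLp_const w).indicator hs), ← integral_indicator hs]
    congr 1
    ext t
    by_cases ht : t ∈ s <;> simp [ht]
  -- A countable dense set of vectors gives one exceptional null set for all of them.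
  filter_upwards [ae_all_iff.2 fun n => h1 (denseSeq E n)] with t ht
  refine DFunLike.coe_injective ?_
  exact Continuous.ext_on (denseRange_denseSeq E) (R t).continuous continuous_const
    (by rintro _ ⟨n, rfl⟩; exact ht n)

end EnergyIdentity

/-! ### Functions with values in `L²` as functions of two variables -/

section Joint

variable {X F : Type*} [MeasurableSpace X] {ν : Measure X} [NormedAddCommGroup F]

/-- The sum of the squared differences is integrable, hence finite almost everywhere. A summable
rate avoids passing to a subsequence, which in the application would depend on time. -/
theorem ae_tendsto_of_tsum_enorm_sub_sq_ne_top {f : ℕ → Lp F 2 ν} {f₀ : Lp F 2 ν}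
    (h : ∑' n, ‖f n - f₀‖ₑ ^ 2 ≠ ⊤) : ∀ᵐ x ∂ν, Tendsto (fun n => f n x) atTop (𝓝 (f₀ x)) := by
  have h1 : ∀ n, ∫⁻ x, ‖(f n - f₀) x‖ₑ ^ 2 ∂ν = ‖f n - f₀‖ₑ ^ 2 := fun n => by
    rw [Lp.enorm_def, eLpNorm_eq_lintegral_rpow_enorm_toReal (by simp) (by simp),
      ← ENNReal.rpow_natCast,
      ← ENNReal.rpow_mul]
    simp
  have h2 : ∫⁻ x, ∑' n, ‖(f n - f₀) x‖ₑ ^ 2 ∂ν ≠ ⊤ := by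
    rw [lintegral_tsum fun n => (Lp.aestronglyMeasurable _).enorm.pow_const 2]
    simpa only [h1] using h
  have hm : AEMeasurable (fun x => ∑' n, ‖(f n - f₀) x‖ₑ ^ 2) ν :=
    AEMeasurable.tsum fun n => (Lp.aestronglyMeasurable _).enorm.pow_const 2
  filter_upwards [ae_lt_top' hm h2, ae_all_iff.2 fun n => Lp.coeFn_sub (f n) f₀] with x hx hs
  have h3 := ENNReal.tendsto_atTop_zero_of_tsum_ne_top hx.ne
  rw [tendsto_iff_edist_tendsto_0]
  have h4 := (ENNReal.continuous_rpow_const (y := (1 / 2 : ℝ))).tendsto 0 |>.comp h3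
  simp only [ENNReal.zero_rpow_of_pos (by norm_num : (0 : ℝ) < 1 / 2)] at h4
  refine h4.congr fun n => ?_
  rw [edist_eq_enorm_sub, Function.comp, hs n, Pi.sub_apply, ← ENNReal.rpow_natCast,
    ← ENNReal.rpow_mul]
  simp

/-- A map into `L²` gives, for each time, only a class of functions of `x`. Replacing `G t` by the
first member of a dense sequence within `2⁻ᵏ` gives jointly measurable approximants, since countably
many functions occur. The rate makes them converge almost everywhere in `x`. -/
theorem exists_stronglyMeasurable_uncurry [CompleteSpace F] [SecondCountableTopology F]
    [SeparableSpace (Lp F 2 ν)] {α : Type*} [MeasurableSpace α] {μ : Measure α}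
    {G : α → Lp F 2 ν} (hG : AEStronglyMeasurable G μ) :
    ∃ S : X × α → F, StronglyMeasurable S ∧ ∀ᵐ t ∂μ, ∀ᵐ x ∂ν, S (x, t) = G t x := by
  borelize F
  let G' := hG.mk G
  let d := denseSeq (Lp F 2 ν)
  have hex : ∀ (k : ℕ) (t : α), ∃ j, ‖d j - G' t‖ < (1 / 2 : ℝ) ^ k := by
    intro k t
    obtain ⟨j, hj⟩ := (denseRange_denseSeq (Lp F 2 ν)).exists_dist_lt (G' t)
      (show (0 : ℝ) < (1 / 2) ^ k by positivity)
    exact ⟨j, by rwa [dist_comm, dist_eq_norm] at hj⟩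
  classical
  let j : ℕ → α → ℕ := fun k t => Nat.find (hex k t)
  have hj : ∀ k, Measurable (j k) := fun k => by
    refine measurable_find (hex k) fun n => ?_
    exact measurableSet_lt
      (stronglyMeasurable_const.sub hG.stronglyMeasurable_mk).norm.measurable measurable_const
  have hd : Measurable fun p : ℕ × X => d p.1 p.2 :=
    measurable_from_prod_countable_right fun n => (Lp.stronglyMeasurable (d n)).measurable
  have hS : ∀ k, StronglyMeasurable fun p : X × α => d (j k p.2) p.1 := fun k =>
    (hd.comp (((hj k).comp measurable_snd).prodMk measurable_fst)).stronglyMeasurable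
  refine ⟨_, StronglyMeasurable.limUnder (l := atTop) hS, ?_⟩
  filter_upwards [hG.ae_eq_mk] with t ht
  have hsum : ∑' k, ‖d (j k t) - G t‖ₑ ^ 2 ≠ ⊤ := by
    have hle : ∀ k, ‖d (j k t) - G t‖ₑ ^ 2 ≤ ENNReal.ofReal ((1 / 4) ^ k) := fun k => by
      rw [← ofReal_norm, ← ENNReal.ofReal_pow (norm_nonneg _)]
      refine ENNReal.ofReal_le_ofReal ?_
      have h1 : ‖d (j k t) - G t‖ ≤ (1 / 2) ^ k := by
        rw [ht]
        exact (Nat.find_spec (hex k t)).le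
      refine (pow_le_pow_left₀ (norm_nonneg _) h1 2).trans_eq ?_
      rw [← pow_mul, mul_comm, pow_mul]
      norm_num
    refine ne_top_of_le_ne_top ?_ (ENNReal.tsum_le_tsum hle)
    exact (summable_geometric_of_lt_one (by norm_num) (by norm_num)).tsum_ofReal_ne_top
  filter_upwards [ae_tendsto_of_tsum_enorm_sub_sq_ne_top hsum] with x hx
  exact hx.limUnder_eq

theorem eLpNorm_two_prod {α : Type*} [MeasurableSpace α] {μ : Measure α} [SFinite μ] [SFinite ν]
    {G : α → Lp F 2 ν} {S : X × α → F} (hS : AEStronglyMeasurable S (ν.prod μ))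
    (h : ∀ᵐ t ∂μ, ∀ᵐ x ∂ν, S (x, t) = G t x) :
    eLpNorm S 2 (ν.prod μ) = eLpNorm G 2 μ := by
  simp only [eLpNorm_eq_lintegral_rpow_enorm_toReal (by simp : (2 : ℝ≥0∞) ≠ 0)
    (by simp : (2 : ℝ≥0∞) ≠ ⊤)]
  rw [lintegral_prod_symm _ (hS.enorm.pow_const _)]
  congr 1
  refine lintegral_congr_ae ?_
  filter_upwards [h] with t ht
  rw [Lp.enorm_def, eLpNorm_eq_lintegral_rpow_enorm_toReal (by simp) (by simp),
    ← ENNReal.rpow_mul]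
  simp only [ENNReal.toReal_ofNat, one_div, isUnit_iff_ne_zero, ne_eq, OfNat.ofNat_ne_zero,
    not_false_eq_true, IsUnit.inv_mul_cancel, ENNReal.rpow_one]
  refine lintegral_congr_ae ?_
  filter_upwards [ht] with x hx
  rw [hx]

end Joint

/-! ### The embedding of `H¹₀` in `L⁴` -/

variable {Ω : Opens Plane}

/-- The inequality passes from test functions to their closure by Fatou's lemma along an almost
everywhere convergent subsequence. -/
theorem eLpNorm_H10_le : ∃ C : NNReal, ∀ p ∈ H10 Ω,
    eLpNorm (fun x => ‖p.1 x‖ ^ 2) 2 (volume.restrict (Ω : Set Plane)) ≤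
      C * (‖p.1‖ₑ * ‖p.2‖ₑ) := by
  obtain ⟨C, hC⟩ := eLpNorm_testGraph_le (Ω := Ω)
  refine ⟨C, fun p hp => ?_⟩
  obtain ⟨q, hq, hlim⟩ := mem_closure_iff_seq_limit.1 hp
  have l1 : Tendsto (fun n => (q n).1) atTop (𝓝 p.1) := (continuous_fst.tendsto _).comp hlim
  have l2 : Tendsto (fun n => (q n).2) atTop (𝓝 p.2) := (continuous_snd.tendsto _).comp hlim
  have l3 : Tendsto (fun n => (C : ℝ≥0∞) * (‖(q n).1‖ₑ * ‖(q n).2‖ₑ)) atTop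
      (𝓝 (C * (‖p.1‖ₑ * ‖p.2‖ₑ))) :=
    ENNReal.Tendsto.const_mul (ENNReal.Tendsto.mul l1.enorm (Or.inr (by simp)) l2.enorm
      (Or.inr (by simp))) (Or.inr (by simp))
  obtain ⟨k, hk, a1⟩ := (tendstoInMeasure_of_tendsto_Lp l1).exists_seq_tendsto_ae
  have hm : ∀ n, AEStronglyMeasurable (fun x => ‖(q (k n)).1 x‖ ^ 2)
      (volume.restrict (Ω : Set Plane)) := fun n => (Lp.aestronglyMeasurable _).norm.pow 2
  refine (Lp.eLpNorm_lim_le_liminf_eLpNorm hm _ ?_).trans ?_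
  · filter_upwards [a1] with x hx
    exact hx.norm.pow 2
  · rw [← (l3.comp hk.tendsto_atTop).liminf_eq]
    exact liminf_le_liminf (Eventually.of_forall fun n => hC _ (hq (k n)))

theorem eLpNorm_four_sq (f : Plane → Plane) (μ : Measure Plane) :
    eLpNorm f 4 μ ^ 2 = eLpNorm (fun x => ‖f x‖ ^ 2) 2 μ := by
  have := eLpNorm_norm_rpow (μ := μ) (p := 2) f (show (0 : ℝ) < 2 by norm_num)
  simp only [Real.rpow_ofNat, ENNReal.rpow_ofNat] at this
  rw [this]
  norm_num

theorem exists_eLpNorm_four_le : ∃ C : NNReal, ∀ p ∈ H10 Ω,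
    eLpNorm p.1 4 (volume.restrict (Ω : Set Plane)) ^ 2 ≤ C * (‖p.1‖ₑ * ‖p.2‖ₑ) := by
  simpa only [eLpNorm_four_sq] using eLpNorm_H10_le (Ω := Ω)

/-- The constant of the Ladyzhenskaya inequality. -/
def ladyzhenskayaConst (Ω : Opens Plane) : NNReal := (exists_eLpNorm_four_le (Ω := Ω)).choose

theorem eLpNorm_four_le {p : L2vec Ω × L2mat Ω} (hp : p ∈ H10 Ω) :
    eLpNorm p.1 4 (volume.restrict (Ω : Set Plane)) ^ 2 ≤
      ladyzhenskayaConst Ω * (‖p.1‖ₑ * ‖p.2‖ₑ) :=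
  (exists_eLpNorm_four_le (Ω := Ω)).choose_spec p hp

theorem memLp_four {p : L2vec Ω × L2mat Ω} (hp : p ∈ H10 Ω) :
    MemLp p.1 4 (volume.restrict (Ω : Set Plane)) := by
  refine ⟨Lp.aestronglyMeasurable _, ?_⟩
  have := (eLpNorm_four_le hp).trans_lt
    (ENNReal.mul_lt_top ENNReal.coe_lt_top (ENNReal.mul_lt_top (by simp) (by simp)))
  by_contra h
  simp [not_lt_top_iff.1 h] at this

instance : Fact ((1 : ℝ≥0∞) ≤ 4) := ⟨by norm_num⟩

instance : ENNReal.HolderTriple 4 4 2 where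
  inv_add_inv_eq_inv := by
    rw [← ENNReal.toReal_eq_toReal_iff' (by simp) (by simp), ENNReal.toReal_add (by simp) (by simp)]
    norm_num

theorem norm_toLp_four_sq_le {p : L2vec Ω × L2mat Ω} (hp : p ∈ H10 Ω) :
    ‖(memLp_four hp).toLp p.1‖ ^ 2 ≤ ladyzhenskayaConst Ω * (‖p.1‖ * ‖p.2‖) := by
  have := ENNReal.toReal_mono (by finiteness) (eLpNorm_four_le hp)
  simpa [Lp.norm_toLp] using this

/-- The embedding of `H¹₀` in `L⁴`. -/
def toL4 : H10 Ω →L[ℝ] Lp Plane 4 (volume.restrict (Ω : Set Plane)) :=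
  LinearMap.mkContinuous
    { toFun := fun p => (memLp_four p.2).toLp p.1.1
      map_add' := fun p q => by
        exact (MemLp.toLp_congr (memLp_four (p + q).2) ((memLp_four p.2).add (memLp_four q.2))
          (Lp.coeFn_add p.1.1 q.1.1)).trans (MemLp.toLp_add _ _)
      map_smul' := fun c p => by
        exact (MemLp.toLp_congr (memLp_four (c • p).2) ((memLp_four p.2).const_smul c)
          (Lp.coeFn_smul c p.1.1)).trans (MemLp.toLp_const_smul _ _) }
    (NNReal.sqrt (ladyzhenskayaConst Ω)) fun p => by
      refine le_of_sq_le_sq ?_ (by positivity)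
      refine (norm_toLp_four_sq_le p.2).trans ?_
      rw [mul_pow, ← NNReal.coe_pow, NNReal.sq_sqrt, sq ‖p‖]
      have h1 : ‖p.1.1‖ ≤ ‖p‖ := norm_fst_le p.1
      have h2 : ‖p.1.2‖ ≤ ‖p‖ := norm_snd_le p.1
      gcongr

theorem toL4_coeFn (p : H10 Ω) : toL4 p =ᵐ[volume.restrict (Ω : Set Plane)] p.1.1 :=
  (memLp_four p.2).coeFn_toLp

/-- The Ladyzhenskaya inequality. -/
theorem norm_toL4_sq_le (p : H10 Ω) :
    ‖toL4 p‖ ^ 2 ≤ ladyzhenskayaConst Ω * (‖p.1.1‖ * ‖p.1.2‖) :=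
  norm_toLp_four_sq_le p.2

attribute [irreducible] toL4

/-! ### Integration by parts -/

/-- The matrix `a ⊗ b`, with entries `aᵢ bⱼ`. -/
def outerL : Plane →L[ℝ] Plane →L[ℝ] Mat :=
  (LinearMap.mk₂ ℝ (fun a b => WithLp.toLp 2 fun p : Fin 2 × Fin 2 => a p.1 * b p.2)
    (fun a a' b => by ext p; simp [add_mul]) (fun c a b => by ext p; simp [mul_assoc])
    (fun a b b' => by ext p; simp [mul_add])
    (fun c a b => by ext p; simp [mul_left_comm])).toContinuousBilinearMap

@[simp]
theorem outerL_apply (a b : Plane) (p : Fin 2 × Fin 2) : outerL a b p = a p.1 * b p.2 := rfl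

/-- The matrix `(a · b) I`. -/
def innerIdL : Plane →L[ℝ] Plane →L[ℝ] Mat :=
  (LinearMap.mk₂ ℝ (fun a b => WithLp.toLp 2 fun p : Fin 2 × Fin 2 =>
      if p.1 = p.2 then a 0 * b 0 + a 1 * b 1 else 0)
    (fun a a' b => by ext p; by_cases h : p.1 = p.2 <;> simp [h]; ring)
    (fun c a b => by ext p; by_cases h : p.1 = p.2 <;> simp [h]; ring)
    (fun a b b' => by ext p; by_cases h : p.1 = p.2 <;> simp [h]; ring)
    (fun c a b => by ext p; by_cases h : p.1 = p.2 <;> simp [h]; ring)).toContinuousBilinearMap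

theorem innerIdL_apply (a b : Plane) (p : Fin 2 × Fin 2) :
    innerIdL a b p = if p.1 = p.2 then a 0 * b 0 + a 1 * b 1 else 0 := rfl

theorem inner_mat (A B : Mat) :
    ⟪A, B⟫ = A (0, 0) * B (0, 0) + A (0, 1) * B (0, 1) + A (1, 0) * B (1, 0) +
      A (1, 1) * B (1, 1) := by
  simp [PiLp.inner_apply, Fintype.sum_prod_type]
  ring

theorem jac_apply (φ : Plane → Plane) (x : Plane) (i j : Fin 2) :
    jac φ x (i, j) = fderiv ℝ φ x (EuclideanSpace.single j 1) i := rfl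

theorem holderL_coeFn {μ : Measure Plane} (B : Plane →L[ℝ] Plane →L[ℝ] Mat)
    (a b : Lp Plane 4 μ) : B.holderL μ 4 4 2 a b =ᵐ[μ] fun x => B (a x) (b x) :=
  B.coeFn_holder (r := 2) a b

/-- Divergence theorem without boundary term: each partial derivative is integrated by parts against
the constant `1`. -/
theorem integral_tr_jac {Φ : Plane → Plane} (h : ContDiff ℝ 1 Φ) (hc : HasCompactSupport Φ) :
    ∫ x, tr (jac Φ x) = 0 := by
  have hd : Differentiable ℝ Φ := h.differentiable one_ne_zero
  have hi : ∀ i j, Integrable (fun x => fderiv ℝ Φ x (EuclideanSpace.single j 1) i) ∧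
      ∫ x, fderiv ℝ Φ x (EuclideanSpace.single j 1) i = 0 := by
    intro i j
    have hcomp : ContDiff ℝ 1 fun x => Φ x i := by fun_prop
    have hcs : HasCompactSupport fun x => Φ x i :=
      hc.comp_left (g := fun y : Plane => y i) (by simp)
    have e : ∀ x, fderiv ℝ (fun x => Φ x i) x (EuclideanSpace.single j 1) =
        fderiv ℝ Φ x (EuclideanSpace.single j 1) i := fun x => by
      have := ((EuclideanSpace.proj (𝕜 := ℝ) i).hasFDerivAt.comp x (hd x).hasFDerivAt).fderiv
      exact congrArg (fun L => L (EuclideanSpace.single j 1)) this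
    have hint : Integrable fun x => fderiv ℝ (fun x => Φ x i) x (EuclideanSpace.single j 1) :=
      ((hcomp.continuous_fderiv one_ne_zero).clm_apply
        continuous_const).integrable_of_hasCompactSupport (hcs.fderiv_apply ℝ _)
    have := integral_mul_fderiv_eq_neg_fderiv_mul_of_integrable (μ := (volume : Measure Plane))
      (f := fun _ => (1 : ℝ)) (g := fun x => Φ x i) (v := EuclideanSpace.single j 1)
      (by simp) (by simpa using hint)
      (by simpa using hcomp.continuous.integrable_of_hasCompactSupport hcs)
      (fun _ _ => differentiableAt_const _) (fun x _ => hcomp.differentiable one_ne_zero x)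
    simp only [one_mul, fderiv_fun_const, Pi.zero_apply, zero_apply, zero_mul,
      integral_zero, neg_zero] at this
    simp only [e] at this hint
    exact ⟨hint, this⟩
  simp only [tr, jac_apply]
  rw [integral_add (hi 0 0).1 (hi 1 1).1, (hi 0 0).2, (hi 1 1).2, add_zero]

theorem setIntegral_tr_jac {Φ : Plane → Plane} (h : ContDiff ℝ 1 Φ) (hc : HasCompactSupport Φ)
    (hΩ : tsupport Φ ⊆ Ω) : ∫ x in (Ω : Set Plane), tr (jac Φ x) = 0 := by
  rw [setIntegral_eq_integral_of_forall_compl_eq_zero, integral_tr_jac h hc]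
  intro x hx
  have : fderiv ℝ Φ x = 0 := by
    by_contra h0
    exact hx (hΩ (support_fderiv_subset ℝ h0))
  simp [tr, jac_apply, this]

theorem mem_testGraph {p : L2vec Ω × L2mat Ω} : p ∈ testGraph Ω ↔
    ∃ φ : 𝓓(Ω, Plane), p.1 =ᵐ[volume.restrict (Ω : Set Plane)] φ ∧
      p.2 =ᵐ[volume.restrict (Ω : Set Plane)] jac φ :=
  Iff.rfl

theorem denseRange_testGraph :
    DenseRange (Submodule.inclusion (testGraph Ω).le_topologicalClosure : testGraph Ω → H10 Ω) :=
  (denseRange_inclusion_iff (testGraph Ω).le_topologicalClosure).2 fun _ h => h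

theorem contDiff_test (φ : 𝓓(Ω, Plane)) : ContDiff ℝ ∞ φ := φ.contDiff

/-- Product rule for the divergence of `(φ · ψ) υ`. The last term is `(φ · ψ) div υ`, which
disappears for divergence-free `υ`. -/
theorem tr_jac_inner_smul {φ ψ υ : Plane → Plane} {x : Plane} (hφ : DifferentiableAt ℝ φ x)
    (hψ : DifferentiableAt ℝ ψ x) (hυ : DifferentiableAt ℝ υ x) :
    tr (jac (fun x => ⟪φ x, ψ x⟫ • υ x) x) =
      ⟪jac φ x, outerL (ψ x) (υ x)⟫ + ⟪jac ψ x, outerL (φ x) (υ x)⟫ +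
        ⟪jac υ x, innerIdL (φ x) (ψ x)⟫ := by
  have h := ((hφ.hasFDerivAt.inner ℝ hψ.hasFDerivAt).smul hυ.hasFDerivAt).fderiv
  change fderiv ℝ (fun x => ⟪φ x, ψ x⟫ • υ x) x = _ at h
  simp only [tr, jac_apply, h, inner_mat, innerIdL_apply]
  simp [PiLp.inner_apply, Fin.sum_univ_two]
  ring

theorem inner_add_inner_add_inner_eq_integral (a b c a' b' c' : L2mat Ω) :
    ⟪a, a'⟫ + ⟪b, b'⟫ + ⟪c, c'⟫ =
      ∫ x in (Ω : Set Plane), (⟪a x, a' x⟫ + ⟪b x, b' x⟫ + ⟪c x, c' x⟫) := by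
  have ha := L2.integrable_inner (𝕜 := ℝ) a a'
  have hb := L2.integrable_inner (𝕜 := ℝ) b b'
  have hc := L2.integrable_inner (𝕜 := ℝ) c c'
  have hab : Integrable (fun x => ⟪a x, a' x⟫ + ⟪b x, b' x⟫) (volume.restrict (Ω : Set Plane)) :=
    ha.add hb
  rw [integral_add hab hc, integral_add ha hb]
  rfl

theorem inner_jac_outer_add (φ ψ υ : 𝓓(Ω, Plane)) {P Q U A B C : L2mat Ω}
    (hP : P =ᵐ[volume.restrict (Ω : Set Plane)] jac φ)
    (hQ : Q =ᵐ[volume.restrict (Ω : Set Plane)] jac ψ)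
    (hU : U =ᵐ[volume.restrict (Ω : Set Plane)] jac υ)
    (hA : A =ᵐ[volume.restrict (Ω : Set Plane)] fun x => outerL (ψ x) (υ x))
    (hB : B =ᵐ[volume.restrict (Ω : Set Plane)] fun x => outerL (φ x) (υ x))
    (hC : C =ᵐ[volume.restrict (Ω : Set Plane)] fun x => innerIdL (φ x) (ψ x)) :
    ⟪P, A⟫ + ⟪Q, B⟫ + ⟪U, C⟫ = 0 := by
  have key := setIntegral_tr_jac (Ω := Ω) (Φ := fun x => ⟪φ x, ψ x⟫ • υ x)
    (((contDiff_test φ).inner ℝ (contDiff_test ψ)).smul (contDiff_test υ) |>.of_le (by simp))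
    (HasCompactSupport.smul_left (f := fun x => ⟪φ x, ψ x⟫) υ.hasCompactSupport)
    ((tsupport_smul_subset_right (fun x => ⟪φ x, ψ x⟫) υ).trans υ.tsupport_subset)
  rw [inner_add_inner_add_inner_eq_integral]
  refine Eq.trans ?_ key
  refine integral_congr_ae ?_
  filter_upwards [hP, hQ, hU, hA, hB, hC] with x a1 a2 a3 a4 a5 a6
  rw [tr_jac_inner_smul ((contDiff_test φ).differentiable (by simp) x)
    ((contDiff_test ψ).differentiable (by simp) x) ((contDiff_test υ).differentiable (by simp) x),
    a1, a2, a3, a4, a5, a6]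

theorem holderL_toL4_coeFn (B : Plane →L[ℝ] Plane →L[ℝ] Mat) {p q : H10 Ω} {φ ψ : Plane → Plane}
    (hp : p.1.1 =ᵐ[volume.restrict (Ω : Set Plane)] φ)
    (hq : q.1.1 =ᵐ[volume.restrict (Ω : Set Plane)] ψ) :
    B.holderL (volume.restrict (Ω : Set Plane)) 4 4 2 (toL4 p) (toL4 q)
      =ᵐ[volume.restrict (Ω : Set Plane)] fun x => B (φ x) (ψ x) := by
  filter_upwards [holderL_coeFn B (toL4 p) (toL4 q), toL4_coeFn p, toL4_coeFn q, hp, hq]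
    with x h1 h2 h3 h4 h5
  rw [h1, h2, h3, h4, h5]

/-- By Hölder and the embedding in `L⁴`, each term is continuous in `(p, q, u)`, so the identity
extends from test functions by density. -/
theorem inner_grad_outer_add (p q u : H10 Ω) :
    ⟪p.1.2, outerL.holderL _ 4 4 2 (toL4 q) (toL4 u)⟫ +
      ⟪q.1.2, outerL.holderL _ 4 4 2 (toL4 p) (toL4 u)⟫ +
      ⟪u.1.2, innerIdL.holderL _ 4 4 2 (toL4 p) (toL4 q)⟫ = 0 := by
  have hc : IsClosed {q : H10 Ω × H10 Ω × H10 Ω |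
      ⟪q.1.1.2, outerL.holderL _ 4 4 2 (toL4 q.2.1) (toL4 q.2.2)⟫ +
      ⟪q.2.1.1.2, outerL.holderL _ 4 4 2 (toL4 q.1) (toL4 q.2.2)⟫ +
      ⟪q.2.2.1.2, innerIdL.holderL _ 4 4 2 (toL4 q.1) (toL4 q.2.1)⟫ = 0} :=
    isClosed_eq (by fun_prop) continuous_const
  refine denseRange_testGraph.induction_on₃ (p := fun p q u : H10 Ω =>
    ⟪p.1.2, outerL.holderL _ 4 4 2 (toL4 q) (toL4 u)⟫ +
      ⟪q.1.2, outerL.holderL _ 4 4 2 (toL4 p) (toL4 u)⟫ +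
      ⟪u.1.2, innerIdL.holderL _ 4 4 2 (toL4 p) (toL4 q)⟫ = 0) hc ?_ p q u
  intro p q u
  have hp := mem_testGraph.1 p.2
  have hq := mem_testGraph.1 q.2
  have hu := mem_testGraph.1 u.2
  exact hp.elim fun φ hφ => hq.elim fun ψ hψ => hu.elim fun υ hυ =>
    inner_jac_outer_add φ ψ υ hφ.2 hψ.2 hυ.2 (holderL_toL4_coeFn outerL hψ.1 hυ.1)
      (holderL_toL4_coeFn outerL hφ.1 hυ.1) (holderL_toL4_coeFn innerIdL hφ.1 hψ.1)

/-! ### Korn's identity -/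

/-- The transposed cofactor matrix, so that `A : cof A = 2 det A`. -/
def cofL : Mat →L[ℝ] Mat :=
  LinearMap.toContinuousLinearMap
    { toFun := fun A => WithLp.toLp 2 fun p : Fin 2 × Fin 2 =>
        if p.1 = p.2 then A (1 - p.1, 1 - p.2) else -A (p.2, p.1)
      map_add' := fun A B => by
        ext p
        by_cases h : p.1 = p.2 <;> simp [h]
        ring
      map_smul' := fun c A => by
        ext p
        by_cases h : p.1 = p.2 <;> simp [h] }

theorem cofL_apply (A : Mat) (p : Fin 2 × Fin 2) :
    cofL A p = if p.1 = p.2 then A (1 - p.1, 1 - p.2) else -A (p.2, p.1) := rfl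

theorem inner_cofL (A : Mat) :
    ⟪A, cofL A⟫ = 2 * (A (0, 0) * A (1, 1) - A (0, 1) * A (1, 0)) := by
  rw [inner_mat]
  simp [cofL_apply]
  ring

/-- The determinant is a null Lagrangian: `2 det ∇φ = div(2 φ₀ J)`, where `J = (∂₁φ₁, -∂₀φ₁)` is
divergence free by symmetry of second derivatives. -/
theorem setIntegral_inner_jac_cofL (φ : 𝓓(Ω, Plane)) :
    ∫ x in (Ω : Set Plane), ⟪jac φ x, cofL (jac φ x)⟫ = 0 := by
  let e : Fin 2 → Plane := fun j => EuclideanSpace.single j 1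
  let J : Plane → Plane := fun x => fderiv ℝ φ x (e 1) 1 • e 0 - fderiv ℝ φ x (e 0) 1 • e 1
  have hφ : ContDiff ℝ 2 φ := contDiff_infty.1 (contDiff_test φ) 2
  have hD : ContDiff ℝ 1 (fderiv ℝ φ) := hφ.fderiv_right (by norm_num)
  have hJ : ContDiff ℝ 1 J := by
    fun_prop
  have h0 : ContDiff ℝ 1 fun x => 2 * φ x 0 := by
    have : ContDiff ℝ 1 φ := hφ.of_le (by norm_num)
    fun_prop
  have hsub : tsupport (fun x => 2 * φ x 0) ⊆ tsupport φ :=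
    closure_mono fun x hx h => hx (by simp [h])
  have hs : tsupport (fun x => (2 * φ x 0) • J x) ⊆ tsupport φ :=
    (tsupport_smul_subset_left (fun x => 2 * φ x 0) J).trans hsub
  have key := setIntegral_tr_jac (Ω := Ω) (Φ := fun x => (2 * φ x 0) • J x) (h0.smul hJ)
    (φ.hasCompactSupport.of_isClosed_subset (isClosed_tsupport _) hs)
    (hs.trans φ.tsupport_subset)
  rw [← key]
  congr 1
  ext x
  have hd2 := (hD.differentiable one_ne_zero x).hasFDerivAt
  have hdφ := (hφ.differentiable two_ne_zero x).hasFDerivAt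
  have p1 : ∀ (f : Plane → Plane) (f' : Plane →L[ℝ] Plane) (i : Fin 2), HasFDerivAt f f' x →
      HasFDerivAt (fun x => f x i) ((EuclideanSpace.proj (𝕜 := ℝ) i).comp f') x := fun f f' i h =>
    (EuclideanSpace.proj (𝕜 := ℝ) i).hasFDerivAt.comp x h
  have p2 : ∀ j, HasFDerivAt (fun x => fderiv ℝ φ x (e j) 1) _ x := fun j =>
    p1 _ _ 1 (hd2.clm_apply (hasFDerivAt_const (e j) x))
  have hsymm : fderiv ℝ (fderiv ℝ φ) x (e 0) (e 1) = fderiv ℝ (fderiv ℝ φ) x (e 1) (e 0) :=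
    (hφ.contDiffAt.isSymmSndFDerivAt (by simp)) (e 0) (e 1)
  have h := (((p1 _ _ 0 hdφ).const_mul 2).smul
    (((p2 1).smul_const (e 0)).sub ((p2 0).smul_const (e 1)))).fderiv
  change fderiv ℝ (fun x => (2 * φ x 0) • J x) x = _ at h
  rw [inner_cofL]
  simp only [tr, jac_apply, h]
  have hsymm' := congrArg (fun v : Plane => v 1) hsymm
  simp [e] at hsymm' ⊢
  rw [hsymm']
  ring

theorem inner_grad_cofL_of_test {p : H10 Ω} (φ : 𝓓(Ω, Plane))
    (h : p.1.2 =ᵐ[volume.restrict (Ω : Set Plane)] jac φ) :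
    ⟪p.1.2, cofL.compLpL 2 (volume.restrict (Ω : Set Plane)) p.1.2⟫ = 0 := by
  rw [L2.inner_def]
  refine Eq.trans ?_ (setIntegral_inner_jac_cofL φ)
  refine integral_congr_ae ?_
  filter_upwards [h, cofL.coeFn_compLpL (p := 2) p.1.2] with x h1 h2
  rw [h2, h1]

theorem inner_grad_cofL (p : H10 Ω) :
    ⟪p.1.2, cofL.compLpL 2 (volume.restrict (Ω : Set Plane)) p.1.2⟫ = 0 := by
  have hc : IsClosed {p : H10 Ω |
    ⟪p.1.2, cofL.compLpL 2 (volume.restrict (Ω : Set Plane)) p.1.2⟫ = 0} :=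
    isClosed_eq (by fun_prop) continuous_const
  refine denseRange_testGraph.induction_on (p := fun p : H10 Ω =>
    ⟪p.1.2, cofL.compLpL 2 (volume.restrict (Ω : Set Plane)) p.1.2⟫ = 0) p hc ?_
  intro q
  have h := mem_testGraph.1 q.2
  exact h.elim fun φ hφ => inner_grad_cofL_of_test φ hφ.2

/-- Pointwise form of Korn's identity. For gradients of fields in `V` the trace is zero and the
cofactor term integrates to zero, which leaves `‖Dv‖² = ‖∇v‖² / 2`. -/
theorem norm_symPart_sq (A : Mat) :
    ‖symPart A‖ ^ 2 = ‖A‖ ^ 2 / 2 + (tr A ^ 2 - ⟪A, cofL A⟫) / 2 := by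
  rw [← real_inner_self_eq_norm_sq, ← real_inner_self_eq_norm_sq, inner_cofL, inner_mat, inner_mat]
  simp [symPart, tr]
  ring

theorem norm_symPart_le (A : Mat) : ‖symPart A‖ ≤ ‖A‖ := by
  refine le_of_sq_le_sq ?_ (norm_nonneg _)
  rw [← real_inner_self_eq_norm_sq, ← real_inner_self_eq_norm_sq, inner_mat, inner_mat]
  simp [symPart]
  nlinarith [sq_nonneg (A (0, 1) - A (1, 0))]

/-! ### The bi-viscosity tensor -/

section Biviscosity

/-- The retraction of a normed space to the ball of radius `γ`. -/
def radialRetract {F : Type*} [NormedAddCommGroup F] [NormedSpace ℝ F] (γ : ℝ) (A : F) : F :=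
  (γ / max ‖A‖ γ) • A

theorem lipschitzWith_radialRetract {F : Type*} [NormedAddCommGroup F] [NormedSpace ℝ F] {γ : ℝ}
    (hγ : 0 ≤ γ) : LipschitzWith 2 (radialRetract γ : F → F) := by
  refine LipschitzWith.of_dist_le_mul fun A B => ?_
  rw [dist_eq_norm, dist_eq_norm]
  rcases hγ.eq_or_lt with rfl | hγ
  · simp [radialRetract]
  set a := max ‖A‖ γ with ha
  set b := max ‖B‖ γ with hb
  have ha0 : 0 < a := lt_max_of_lt_right hγ
  have hb0 : 0 < b := lt_max_of_lt_right hγ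
  -- The change of the vector and the change of the scalar factor are separated. Each contributes at
  -- most `‖A - B‖`, whence the constant 2.
  have e : radialRetract γ A - radialRetract γ B =
      (γ / a) • (A - B) + (γ * (b - a) / (a * b)) • B := by
    have : γ * (b - a) / (a * b) = γ / a - γ / b := by field_simp
    rw [this, sub_smul, smul_sub, radialRetract, radialRetract]
    abel
  have h1 : ‖(γ / a) • (A - B)‖ ≤ ‖A - B‖ := by
    rw [norm_smul, Real.norm_of_nonneg (by positivity)]
    exact mul_le_of_le_one_left (norm_nonneg _) ((div_le_one ha0).2 (le_max_right _ _))
  have h2 : |b - a| ≤ ‖A - B‖ := by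
    refine (abs_max_sub_max_le_abs _ _ _).trans ?_
    rw [abs_sub_comm]
    exact abs_norm_sub_norm_le A B
  have h3 : ‖(γ * (b - a) / (a * b)) • B‖ ≤ ‖A - B‖ := by
    rw [norm_smul, norm_div, norm_mul, Real.norm_of_nonneg hγ.le, Real.norm_eq_abs,
      Real.norm_of_nonneg (by positivity), div_mul_eq_mul_div, div_le_iff₀ (by positivity)]
    calc γ * |b - a| * ‖B‖ ≤ a * ‖A - B‖ * b := by
          gcongr
          · exact le_max_right _ _
          · exact le_max_left _ _
      _ = ‖A - B‖ * (a * b) := by ring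
  rw [e]
  refine (norm_add_le _ _).trans ?_
  rw [NNReal.coe_ofNat]
  linarith

variable {μ τy : ℝ} {m : ℕ}

/-- Since `2μ(m - 1)γₘ = τ_y`, the yield part is a multiple of the retraction to the ball of radius
`γₘ`. This shows that `τₘ` is Lipschitz. The constant depends on `m`, but it serves only for
continuity and measurability. -/
theorem biviscosity_eq (hμ : 0 < μ) (hτy : 0 ≤ τy) (hm : 2 ≤ m) (A : Mat) :
    biviscosity μ τy m A = (2 * μ) • A +
      (2 * μ * ((m : ℝ) - 1)) • radialRetract (τy / (2 * μ * ((m : ℝ) - 1))) A := by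
  have hm1 : (0 : ℝ) < (m : ℝ) - 1 := by
    have : (2 : ℝ) ≤ m := by exact_mod_cast hm
    linarith
  rw [biviscosity, radialRetract, smul_smul, ← add_smul]
  split_ifs with h
  · rw [max_eq_right h]
    -- For `τ_y = 0` the quotient `γ / γ` has the default value `0`, but the ball then contains only
    -- `A = 0`.
    rcases hτy.eq_or_lt with rfl | hτ
    · have : A = 0 := by simpa using h
      simp [this]
    · rw [div_self (by positivity)]
      congr 1
      ring
  · rw [max_eq_left (not_le.1 h).le]
    congr 2
    field_simp

theorem lipschitzWith_biviscosity (hμ : 0 < μ) (hτy : 0 ≤ τy) (hm : 2 ≤ m) :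
    ∃ c, LipschitzWith c (biviscosity μ τy m) := by
  have hm1 : (0 : ℝ) ≤ (m : ℝ) - 1 := by
    have : (2 : ℝ) ≤ m := by exact_mod_cast hm
    linarith
  rw [funext (biviscosity_eq hμ hτy hm)]
  exact ⟨_, (lipschitzWith_smul (2 * μ)).add
    ((lipschitzWith_smul (2 * μ * ((m : ℝ) - 1))).comp
      (lipschitzWith_radialRetract (by positivity)))⟩

theorem biviscosity_zero : biviscosity μ τy m 0 = 0 := by
  simp [biviscosity]

/-- Below the threshold the excess viscosity contributes `2μ(m - 1)|A| ≤ τ_y`, so the bound is free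
of `m`. -/
theorem norm_biviscosity_le (hμ : 0 < μ) (hτy : 0 ≤ τy) (hm : 2 ≤ m) (A : Mat) :
    ‖biviscosity μ τy m A‖ ≤ 2 * μ * ‖A‖ + τy := by
  have hm1 : (0 : ℝ) < (m : ℝ) - 1 := by
    have : (2 : ℝ) ≤ m := by exact_mod_cast hm
    linarith
  rw [biviscosity]
  split_ifs with h
  · rw [norm_smul, Real.norm_of_nonneg (by positivity)]
    rw [le_div_iff₀ (by positivity)] at h
    linarith
  · have hA : 0 < ‖A‖ := lt_of_le_of_lt (by positivity) (not_le.1 h)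
    rw [norm_smul, Real.norm_of_nonneg (by positivity), add_mul, div_mul_cancel₀ _ hA.ne']

theorem le_inner_biviscosity (hμ : 0 < μ) (hτy : 0 ≤ τy) (hm : 2 ≤ m) (A : Mat) :
    2 * μ * ‖A‖ ^ 2 ≤ ⟪biviscosity μ τy m A, A⟫ := by
  have hm1 : (1 : ℝ) ≤ (m : ℝ) := by exact_mod_cast (by omega : 1 ≤ m)
  rw [biviscosity]
  split_ifs with h
  all_goals
    rw [real_inner_smul_left, real_inner_self_eq_norm_sq]
    refine mul_le_mul_of_nonneg_right ?_ (sq_nonneg _)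
  · nlinarith
  · have : 0 ≤ τy / ‖A‖ := by positivity
    linarith

/-- The stress is a multiple of a symmetric matrix, hence orthogonal to antisymmetric parts. The
strain of a test field may thus be replaced by its gradient. -/
theorem inner_biviscosity_symPart (A B : Mat) :
    ⟪biviscosity μ τy m (symPart A), symPart B⟫ = ⟪biviscosity μ τy m (symPart A), B⟫ := by
  have h : ⟪symPart A, symPart B⟫ = ⟪symPart A, B⟫ := by
    rw [inner_mat, inner_mat]
    simp [symPart]
    ring
  rw [biviscosity]
  split_ifs <;> rw [real_inner_smul_left, real_inner_smul_left, h]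

end Biviscosity

/-! ### The terms of the equation as functionals on `V` -/

/-- The inclusion of `V` in `H¹₀`. -/
def V.toH10 : V Ω →ₗ[ℝ] H10 Ω := Submodule.inclusion fun _ hp => hp.1

theorem V.toH10_fst (v : V Ω) : (V.toH10 v).1.1 = V.toL2 v := rfl

theorem V.toH10_snd (v : V Ω) : (V.toH10 v).1.2 = V.grad v := rfl

attribute [irreducible] V.toH10

theorem V.tr_grad (v : V Ω) : ∀ᵐ x ∂volume.restrict (Ω : Set Plane), tr (V.grad v x) = 0 := v.2.2

theorem V.norm_grad (v : V Ω) : ‖V.grad v‖ = ‖v‖ := rfl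

theorem V.norm_toH (v : V Ω) : ‖V.toH v‖ = ‖V.toL2 v‖ := rfl

/-- The gradient as an isometry. -/
def V.gradL : V Ω →ₗᵢ[ℝ] L2mat Ω := ⟨V.grad, V.norm_grad⟩

instance : SeparableSpace (V Ω) := by
  have : Fact ((2 : ℝ≥0∞) ≠ ⊤) := ⟨by simp⟩
  have : SecondCountableTopology (V Ω) :=
    V.gradL.isometry.isEmbedding.secondCountableTopology
  infer_instance

/-- The functional `w ↦ ∫ S : ∇w` on `V`. -/
def divDual : L2mat Ω →L[ℝ] StrongDual ℝ (V Ω) :=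
  (ContinuousLinearMap.compL ℝ (V Ω) (L2mat Ω) ℝ).flip V.gradL.toContinuousLinearMap ∘L innerSL ℝ

theorem divDual_apply (S : L2mat Ω) (w : V Ω) : divDual S w = ⟪S, V.grad w⟫ := rfl

theorem norm_divDual_le (S : L2mat Ω) : ‖divDual S‖ ≤ ‖S‖ := by
  refine ContinuousLinearMap.opNorm_le_bound _ (norm_nonneg _) fun w => ?_
  rw [divDual_apply]
  exact norm_inner_le_norm _ _

/-- The linear map `A ↦ (A + Aᵀ) / 2`. -/
def symPartL : Mat →L[ℝ] Mat :=
  LinearMap.toContinuousLinearMap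
    { toFun := symPart
      map_add' := fun A B => by
        ext p
        simp [symPart]
        ring
      map_smul' := fun c A => by
        ext p
        simp [symPart]
        ring }

theorem symPartL_apply (A : Mat) : symPartL A = symPart A := rfl

/-- The stress tensor `τₘ(Dv)` as a function of `∇v` is a continuous operator in `L²`. -/
theorem exists_stress {μ τy : ℝ} {m : ℕ} (hμ : 0 < μ) (hτy : 0 ≤ τy) (hm : 2 ≤ m) :
    ∃ N : L2mat Ω → L2mat Ω, Continuous N ∧ ∀ G, N G =ᵐ[volume.restrict (Ω : Set Plane)]
      fun x => biviscosity μ τy m (symPart (G x)) := by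
  obtain ⟨c, hc⟩ := lipschitzWith_biviscosity hμ hτy hm
  refine ⟨fun G => hc.compLp biviscosity_zero (symPartL.compLp G),
    (hc.continuous_compLp biviscosity_zero).comp
      (symPartL.compLpL 2 (volume.restrict (Ω : Set Plane))).continuous, fun G => ?_⟩
  filter_upwards [hc.coeFn_compLp biviscosity_zero (symPartL.compLp G), symPartL.coeFn_compLp G]
    with x h1 h2
  rw [h1, Function.comp, h2, symPartL_apply]

theorem inner_cofL_eq_zero {p : H10 Ω} {G : L2mat Ω} (h : p.1.2 = G) :
    ⟪G, cofL.compLpL 2 (volume.restrict (Ω : Set Plane)) G⟫ = 0 :=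
  h ▸ inner_grad_cofL p

theorem eLpNorm_two_le_of_norm_le_add {α F G : Type*} [MeasurableSpace α] {μ : Measure α}
    [NormedAddCommGroup F] [NormedAddCommGroup G] {f : α → F} {g : α → G} {a κ : ℝ}
    (hg : AEStronglyMeasurable g μ) (ha : 0 ≤ a) (hκ : 0 ≤ κ)
    (h : ∀ᵐ x ∂μ, ‖f x‖ ≤ a * ‖g x‖ + κ) :
    eLpNorm f 2 μ ≤ ENNReal.ofReal a * eLpNorm g 2 μ +
      ENNReal.ofReal κ * μ univ ^ (1 / 2 : ℝ) := by
  have h1 : eLpNorm f 2 μ ≤ eLpNorm (a • (fun x => ‖g x‖) + fun _ => κ) 2 μ :=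
    eLpNorm_mono_ae (h.mono fun x hx => hx.trans (le_abs_self _))
  refine h1.trans ((eLpNorm_add_le (hg.norm.const_smul _) aestronglyMeasurable_const
    one_le_two).trans ?_)
  rw [eLpNorm_const_smul, eLpNorm_norm, eLpNorm_const' _ (by simp) (by simp),
    Real.enorm_of_nonneg hκ, Real.enorm_of_nonneg ha]
  simp

section Stress

variable {μ τy : ℝ} {m : ℕ} {v : V Ω} {S : L2mat Ω}

theorem divDual_stress_apply
    (hS : S =ᵐ[volume.restrict (Ω : Set Plane)] fun x => biviscosity μ τy m (strain v x))
    (w : V Ω) : divDual S w =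
      ∫ x in (Ω : Set Plane), ⟪biviscosity μ τy m (strain v x), strain w x⟫ := by
  rw [divDual_apply, L2.inner_def]
  refine integral_congr_ae ?_
  filter_upwards [hS] with x hx
  rw [hx, strain, strain, inner_biviscosity_symPart]

/-- Finite area enters here, to make the constant `τ_y` square integrable. -/
theorem norm_stress_le (hΩ : volume (Ω : Set Plane) ≠ ⊤) (hμ : 0 < μ) (hτy : 0 ≤ τy) (hm : 2 ≤ m)
    (hS : S =ᵐ[volume.restrict (Ω : Set Plane)] fun x => biviscosity μ τy m (strain v x)) :
    ‖S‖ ≤ 2 * μ * ‖v‖ + τy * (volume (Ω : Set Plane) ^ (1 / 2 : ℝ)).toReal := by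
  have h1 := eLpNorm_two_le_of_norm_le_add (μ := volume.restrict (Ω : Set Plane)) (f := S)
    (g := V.grad v) (a := 2 * μ) (κ := τy) (Lp.aestronglyMeasurable _) (by positivity) hτy (by
      filter_upwards [hS] with x hx
      rw [hx]
      refine (norm_biviscosity_le hμ hτy hm _).trans ?_
      have := norm_symPart_le (V.grad v x)
      rw [strain]
      gcongr)
  rw [Measure.restrict_apply_univ, ← Lp.enorm_def, ← Lp.enorm_def] at h1
  have h2 := ENNReal.toReal_mono (by finiteness) h1
  rw [ENNReal.toReal_add (by finiteness) (by finiteness), ENNReal.toReal_mul, ENNReal.toReal_mul,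
    ENNReal.toReal_ofReal (by positivity), ENNReal.toReal_ofReal hτy, toReal_enorm,
    toReal_enorm, V.norm_grad] at h2
  exact h2

/-- For trace-free `A`, `2μ|sym A|² = μ|A|² - μ A : cof A`, and `h0` removes the last term after
integration. Half of the factor `2μ` is lost in passing from strain to gradient. -/
theorem le_inner_stress (hμ : 0 < μ) (hτy : 0 ≤ τy) (hm : 2 ≤ m) {G K : L2mat Ω}
    (hS : S =ᵐ[volume.restrict (Ω : Set Plane)] fun x => biviscosity μ τy m (symPart (G x)))
    (hG : ∀ᵐ x ∂volume.restrict (Ω : Set Plane), tr (G x) = 0)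
    (hK : K =ᵐ[volume.restrict (Ω : Set Plane)] fun x => cofL (G x)) (h0 : ⟪G, K⟫ = 0) :
    μ * ‖G‖ ^ 2 ≤ ⟪S, G⟫ := by
  have key : 0 ≤ ⟪S, G⟫ + ⟪(-μ) • G, G⟫ + ⟪μ • G, K⟫ := by
    rw [inner_add_inner_add_inner_eq_integral]
    refine integral_nonneg_of_ae ?_
    filter_upwards [hS, hG, hK, Lp.coeFn_smul (-μ) G, Lp.coeFn_smul μ G] with x h1 h2 h3 h4 h5
    have h6 := norm_symPart_sq (G x)
    have h7 := le_inner_biviscosity hμ hτy hm (symPart (G x))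
    rw [inner_biviscosity_symPart, h6, h2] at h7
    rw [h1, h3, h4, h5, Pi.smul_apply, Pi.smul_apply, real_inner_smul_left,
      real_inner_smul_left, real_inner_self_eq_norm_sq]
    simp only [Pi.zero_apply]
    linarith
  rw [real_inner_smul_left, real_inner_smul_left, h0, real_inner_self_eq_norm_sq] at key
  linarith

theorem le_divDual_stress (hμ : 0 < μ) (hτy : 0 ≤ τy) (hm : 2 ≤ m)
    (hS : S =ᵐ[volume.restrict (Ω : Set Plane)] fun x => biviscosity μ τy m (strain v x)) :
    μ * ‖v‖ ^ 2 ≤ divDual S v :=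
  le_inner_stress hμ hτy hm hS v.tr_grad (cofL.coeFn_compLpL (p := 2) (V.grad v))
    (inner_cofL_eq_zero v.toH10_snd)

end Stress

/-- The tensor `u ⊗ v` in `L²`. -/
def tensor (p q : H10 Ω) : L2mat Ω :=
  outerL.holderL (volume.restrict (Ω : Set Plane)) 4 4 2 (toL4 p) (toL4 q)

theorem continuous_tensor_self : Continuous fun p : H10 Ω => tensor p p := by
  unfold tensor
  fun_prop

theorem tensor_coeFn (p q : H10 Ω) : tensor p q =ᵐ[volume.restrict (Ω : Set Plane)]
    fun x => outerL (p.1.1 x) (q.1.1 x) :=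
  holderL_toL4_coeFn outerL (ae_eq_refl _) (ae_eq_refl _)

theorem norm_tensor_le (p q : H10 Ω) : ‖tensor p q‖ ≤ ‖outerL‖ * ‖toL4 p‖ * ‖toL4 q‖ :=
  outerL.norm_holder_apply_apply_le (r := 2) _ _

theorem inner_innerId_eq_zero {G B : L2mat Ω} {a b : Plane → Plane}
    (hG : ∀ᵐ x ∂volume.restrict (Ω : Set Plane), tr (G x) = 0)
    (hB : B =ᵐ[volume.restrict (Ω : Set Plane)] fun x => innerIdL (a x) (b x)) : ⟪G, B⟫ = 0 := by
  rw [L2.inner_def]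
  refine integral_eq_zero_of_ae ?_
  filter_upwards [hG, hB] with x h1 h2
  rw [h2, inner_mat]
  simp only [innerIdL_apply, Pi.zero_apply]
  rw [tr] at h1
  simp [← add_mul, h1]

/-- Antisymmetry of the trilinear form `∫ (u · ∇)p · q` in `p` and `q`, for divergence-free `u`. -/
theorem inner_grad_tensor_add {p q u : H10 Ω} {P Q U : L2mat Ω} (hP : p.1.2 = P)
    (hQ : q.1.2 = Q) (hU : u.1.2 = U)
    (htr : ∀ᵐ x ∂volume.restrict (Ω : Set Plane), tr (U x) = 0) :
    ⟪P, tensor q u⟫ + ⟪Q, tensor p u⟫ = 0 := by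
  subst hP hQ hU
  have h := inner_grad_outer_add p q u
  have h0 := inner_innerId_eq_zero htr (holderL_coeFn innerIdL (toL4 p) (toL4 q))
  exact (add_eq_left.2 h0).symm.trans h

attribute [irreducible] tensor

theorem norm_tensor_self_le_of_eq {p : H10 Ω} {a : L2vec Ω} {b : L2mat Ω} (ha : p.1.1 = a)
    (hb : p.1.2 = b) : ‖tensor p p‖ ≤ ‖outerL‖ * ladyzhenskayaConst Ω * (‖a‖ * ‖b‖) := by
  subst ha hb
  calc ‖tensor p p‖ ≤ ‖outerL‖ * ‖toL4 p‖ * ‖toL4 p‖ := norm_tensor_le p p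
    _ = ‖outerL‖ * ‖toL4 p‖ ^ 2 := by ring
    _ ≤ ‖outerL‖ * (ladyzhenskayaConst Ω * (‖p.1.1‖ * ‖p.1.2‖)) :=
      mul_le_mul_of_nonneg_left (norm_toL4_sq_le p) outerL.opNorm_nonneg
    _ = _ := (mul_assoc _ _ _).symm

theorem norm_tensor_self_le (v : V Ω) : ‖tensor v.toH10 v.toH10‖ ≤
    ‖outerL‖ * ladyzhenskayaConst Ω * (‖V.toH v‖ * ‖v‖) :=
  norm_tensor_self_le_of_eq v.toH10_fst v.toH10_snd

/-- Moving the derivative to `w` leaves only `v ⊗ v`, whose `L²` norm the Ladyzhenskaya inequality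
controls. -/
theorem inner_grad_tensor (v w : V Ω) :
    ⟪V.grad v, tensor w.toH10 v.toH10⟫ = -divDual (tensor v.toH10 v.toH10) w := by
  have h := inner_grad_tensor_add v.toH10_snd w.toH10_snd v.toH10_snd v.tr_grad
  rw [divDual_apply, real_inner_comm (V.grad w)]
  exact eq_neg_of_add_eq_zero_left h

theorem divDual_tensor_self (v : V Ω) : divDual (tensor v.toH10 v.toH10) v = 0 := by
  have h := inner_grad_tensor_add v.toH10_snd v.toH10_snd v.toH10_snd v.tr_grad
  rw [divDual_apply, real_inner_comm (V.grad v)]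
  linarith

theorem inner_convect_ae_eq (v w : V Ω) :
    (fun x => ⟪convect v x, V.toL2 w x⟫) =ᵐ[volume.restrict (Ω : Set Plane)]
      fun x => ⟪V.grad v x, tensor w.toH10 v.toH10 x⟫ := by
  filter_upwards [tensor_coeFn w.toH10 v.toH10] with x h1
  rw [h1, inner_mat, V.toH10_fst, V.toH10_fst]
  simp [convect, PiLp.inner_apply, Fin.sum_univ_two]
  ring

theorem integrableOn_inner_convect (v w : V Ω) :
    IntegrableOn (fun x => ⟪convect v x, V.toL2 w x⟫) Ω :=
  (integrable_congr (inner_convect_ae_eq v w)).2 (L2.integrable_inner _ _)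

theorem integral_inner_convect (v w : V Ω) :
    ∫ x in (Ω : Set Plane), ⟪convect v x, V.toL2 w x⟫ =
      -divDual (tensor v.toH10 v.toH10) w := by
  rw [← inner_grad_tensor, L2.inner_def]
  exact integral_congr_ae (inner_convect_ae_eq v w)

/-! ### The a priori estimates -/

variable {T μ τy : ℝ} {f g : ℝ → StrongDual ℝ (V Ω)} {u₀ : H Ω} {m : ℕ}
  {u : ℝ → V Ω}

/-! ### Pairing of square-integrable functions with values in a space and its dual -/

section Dual

variable {α E F : Type*} [MeasurableSpace α] {ν : Measure α} [NormedAddCommGroup E]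
  [NormedSpace ℝ E] [NormedAddCommGroup F] [NormedSpace ℝ F]

theorem integrable_dual_apply {L : α → StrongDual ℝ E} {φ : α → E}
    (hL : MemLp L 2 ν) (hφ : MemLp φ 2 ν) : Integrable (fun t => L t (φ t)) ν :=
  memLp_one_iff_integrable.1
    ((ContinuousLinearMap.id ℝ (StrongDual ℝ E)).memLp_of_bilin 1 hL hφ)

theorem integrable_dual_norm_sq {L : α → StrongDual ℝ E} (hL : MemLp L 2 ν) :
    Integrable (fun t => ‖L t‖ ^ 2) ν :=
  hL.integrable_norm_pow (by simp)

theorem memLp_dual_comp (A : F →L[ℝ] StrongDual ℝ E) {S : α → F} (hS : MemLp S 2 ν) :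
    MemLp (fun t => A (S t)) 2 ν :=
  A.comp_memLp' hS

theorem dual_ae_eq_of_forall_integral [IsFiniteMeasure ν] [SeparableSpace E]
    {g f A B : α → StrongDual ℝ E} (hg : MemLp g 2 ν) (hf : MemLp f 2 ν) (hA : MemLp A 2 ν)
    (hB : MemLp B 2 ν) (h : ∀ φ : α → E, MemLp φ 2 ν → (∫ t, g t (φ t) ∂ν) +
      (∫ t, A t (φ t) ∂ν) + (∫ t, -B t (φ t) ∂ν) = ∫ t, f t (φ t) ∂ν) :
    ∀ᵐ t ∂ν, g t = f t - A t + B t := by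
  have key := ae_eq_zero_of_forall_integral_apply_eq_zero
    (hg.sub ((hf.sub hA).add hB)) ?_
  · filter_upwards [key] with t ht
    exact sub_eq_zero.1 ht
  · intro φ hφ
    have h := h φ hφ
    have i1 := integrable_dual_apply hg hφ
    have i2 := integrable_dual_apply hf hφ
    have i3 := integrable_dual_apply hA hφ
    have i4 := integrable_dual_apply hB hφ
    have e := integral_sub i1 ((i2.sub i3).add i4)
    rw [integral_add' (i2.sub i3) i4, integral_sub' i2 i3] at e
    rw [integral_neg] at h
    refine e.trans ?_
    linarith

end Dual

/-- `V` carries only the gradient norm, while `H10` carries the topology of the pair `(v, ∇v)`.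
Measurability of the first component is therefore a separate hypothesis, supplied by the continuous
representative in `H`. -/
theorem aestronglyMeasurable_toH10 {ν : Measure ℝ} (hu : AEStronglyMeasurable u ν)
    (hH : AEStronglyMeasurable (fun t => V.toH (u t)) ν) :
    AEStronglyMeasurable (fun t => V.toH10 (u t)) ν := by
  refine (Topology.IsEmbedding.subtypeVal.aestronglyMeasurable_comp_iff).1 ?_
  have h1 : AEStronglyMeasurable (fun t => V.toL2 (u t)) ν :=
    continuous_subtype_val.comp_aestronglyMeasurable hH
  have h2 : AEStronglyMeasurable (fun t => V.grad (u t)) ν :=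
    V.gradL.continuous.comp_aestronglyMeasurable hu
  refine (h1.prodMk h2).congr (Eventually.of_forall fun t => ?_)
  exact (Prod.ext (V.toH10_fst (u t)) (V.toH10_snd (u t))).symm

theorem norm_tensor_self_le_mul {c : ℝ} {v : V Ω} (h : ‖V.toH v‖ ≤ c) :
    ‖tensor v.toH10 v.toH10‖ ≤ ‖outerL‖ * ladyzhenskayaConst Ω * c * ‖v‖ := by
  refine (norm_tensor_self_le v).trans ?_
  rw [mul_assoc _ c]
  exact mul_le_mul_of_nonneg_left (mul_le_mul_of_nonneg_right h (norm_nonneg v))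
    (mul_nonneg outerL.opNorm_nonneg NNReal.zero_le_coe)

theorem memLp_tensor {ν : Measure ℝ} (hu : MemLp u 2 ν)
    (hH : AEStronglyMeasurable (fun t => V.toH (u t)) ν) {c : ℝ}
    (h : ∀ᵐ t ∂ν, ‖V.toH (u t)‖ ≤ c) :
    MemLp (fun t => tensor (u t).toH10 (u t).toH10) 2 ν :=
  hu.of_le_mul (continuous_tensor_self.comp_aestronglyMeasurable
    (aestronglyMeasurable_toH10 hu.1 hH)) (h.mono fun _ ht => norm_tensor_self_le_mul ht)

/-! ### The equation in `V'` and the energy estimate -/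

namespace IsApproxSolution

theorem aestronglyMeasurable_toH (hs : IsApproxSolution T μ τy f u₀ m u g) :
    AEStronglyMeasurable (fun t => V.toH (u t)) (timeMeasure T) := by
  obtain ⟨U, hU, -, h⟩ := hs.initial
  have : AEStronglyMeasurable U (timeMeasure T) :=
    (hU.mono Ioo_subset_Icc_self).aestronglyMeasurable measurableSet_Ioo
  exact this.congr (h.mono fun t ht => ht.symm)

/-- This bound depends on `u`. It only ensures that the convective term is square integrable in
time, so that the equation can be read in `V'` before the uniform estimate is known. -/
theorem exists_norm_toH_le (hs : IsApproxSolution T μ τy f u₀ m u g) :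
    ∃ c, ∀ᵐ t ∂timeMeasure T, ‖V.toH (u t)‖ ≤ c := by
  obtain ⟨U, hU, -, h⟩ := hs.initial
  obtain ⟨c, hc⟩ := isCompact_Icc.exists_bound_of_continuousOn hU
  refine ⟨c, ?_⟩
  filter_upwards [h, ae_restrict_mem measurableSet_Ioo] with t h1 h2
  rw [h1]
  exact hc t (Ioo_subset_Icc_self h2)

/-- The equation as an identity in `V'` for almost every time. -/
theorem equation_ae (hs : IsApproxSolution T μ τy f u₀ m u g) (hf : MemLp f 2 (timeMeasure T))
    {S : ℝ → L2mat Ω} (hSm : MemLp S 2 (timeMeasure T))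
    (hS : ∀ t, S t =ᵐ[volume.restrict (Ω : Set Plane)]
      fun x => biviscosity μ τy m (strain (u t) x))
    (hB : MemLp (fun t => tensor (u t).toH10 (u t).toH10) 2 (timeMeasure T)) :
    ∀ᵐ t ∂timeMeasure T,
      g t = f t - divDual (S t) + divDual (tensor (u t).toH10 (u t).toH10) := by
  have hg' : MemLp g 2 (timeMeasure T) := hs.memLp_deriv
  have hS' : MemLp (fun t => divDual (S t)) 2 (timeMeasure T) := memLp_dual_comp divDual hSm
  have hB' : MemLp (fun t => divDual (tensor (u t).toH10 (u t).toH10)) 2 (timeMeasure T) :=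
    memLp_dual_comp divDual hB
  refine dual_ae_eq_of_forall_integral hg' hf hS' hB' fun φ hφ => ?_
  have h := hs.weak_form φ hφ
  simp only [integral_inner_convect, ← divDual_stress_apply (hS _)] at h
  exact h

/-- Twice the dissipation is at least `2μ‖u‖²`; Young's inequality with weight `μ` spends half of it
on the force. -/
theorem apply_le (hs : IsApproxSolution T μ τy f u₀ m u g) (hμ : 0 < μ) (hτy : 0 ≤ τy)
    (hm : 2 ≤ m) (hf : MemLp f 2 (timeMeasure T))
    {S : ℝ → L2mat Ω} (hSm : MemLp S 2 (timeMeasure T))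
    (hS : ∀ t, S t =ᵐ[volume.restrict (Ω : Set Plane)]
      fun x => biviscosity μ τy m (strain (u t) x))
    (hB : MemLp (fun t => tensor (u t).toH10 (u t).toH10) 2 (timeMeasure T)) :
    ∀ᵐ t ∂timeMeasure T, 2 * g t (u t) ≤ ‖f t‖ ^ 2 / μ - μ * ‖u t‖ ^ 2 := by
  filter_upwards [hs.equation_ae hf hSm hS hB] with t ht
  have h1 : g t (u t) = f t (u t) - divDual (S t) (u t) +
      divDual (tensor (u t).toH10 (u t).toH10) (u t) := by
    rw [ht]
    rfl
  rw [divDual_tensor_self] at h1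
  have h2 := le_divDual_stress hμ hτy hm (hS t)
  have h3 : f t (u t) ≤ ‖f t‖ * ‖u t‖ := (le_abs_self _).trans ((f t).le_opNorm (u t))
  have h4 : 2 * (‖f t‖ * ‖u t‖) ≤ ‖f t‖ ^ 2 / μ + μ * ‖u t‖ ^ 2 := by
    rw [div_add' _ _ _ hμ.ne', le_div_iff₀ hμ]
    nlinarith [sq_nonneg (‖f t‖ - μ * ‖u t‖)]
  linarith

/-- The energy estimate. -/
theorem energy_le (hs : IsApproxSolution T μ τy f u₀ m u g) (hμ : 0 < μ) (hτy : 0 ≤ τy)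
    (hm : 2 ≤ m) (hf : MemLp f 2 (timeMeasure T))
    {S : ℝ → L2mat Ω} (hSm : MemLp S 2 (timeMeasure T))
    (hS : ∀ t, S t =ᵐ[volume.restrict (Ω : Set Plane)]
      fun x => biviscosity μ τy m (strain (u t) x))
    (hB : MemLp (fun t => tensor (u t).toH10 (u t).toH10) 2 (timeMeasure T))
    {U : ℝ → H Ω} (hU : ContinuousOn U (Icc 0 T)) (hU0 : U 0 = u₀)
    (huU : ∀ᵐ t ∂timeMeasure T, V.toH (u t) = U t) {b : ℝ} (hb : 0 < b) (hbT : b < T) :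
    ‖U b‖ ^ 2 + μ * ∫ t in Ioo 0 b, ‖u t‖ ^ 2 ≤
      ‖u₀‖ ^ 2 + (∫ t in Ioo 0 T, ‖f t‖ ^ 2) / μ := by
  have hg : MemLp g 2 (timeMeasure T) := hs.memLp_deriv
  have hE := energy_identity (i := V.toH) hg hs.memLp hU huU hs.deriv_eq hb hbT
  rw [hU0] at hE
  have hsub : Ioo 0 b ⊆ Ioo 0 T := Ioo_subset_Ioo_right hbT.le
  have hf2 : IntegrableOn (fun t => ‖f t‖ ^ 2) (Ioo 0 T) := integrable_dual_norm_sq hf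
  have hu2 : IntegrableOn (fun t => ‖u t‖ ^ 2) (Ioo 0 T) := hs.memLp.integrable_norm_pow (by simp)
  have hgu : IntegrableOn (fun t => g t (u t)) (Ioo 0 T) := integrable_dual_apply hg hs.memLp
  have h1 : 2 * ∫ t in Ioo 0 b, g t (u t) ≤
      (∫ t in Ioo 0 b, ‖f t‖ ^ 2) / μ - μ * ∫ t in Ioo 0 b, ‖u t‖ ^ 2 := by
    rw [← integral_const_mul, ← integral_const_mul, ← integral_div, ← integral_sub
      ((hf2.mono_set hsub).div_const μ) ((hu2.mono_set hsub).const_mul μ)]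
    exact setIntegral_mono_ae_restrict ((hgu.mono_set hsub).const_mul 2)
      (((hf2.mono_set hsub).div_const μ).sub ((hu2.mono_set hsub).const_mul μ))
      (ae_restrict_of_ae_restrict_of_subset hsub (hs.apply_le hμ hτy hm hf hSm hS hB))
  have h2 : (∫ t in Ioo 0 b, ‖f t‖ ^ 2) / μ ≤ (∫ t in Ioo 0 T, ‖f t‖ ^ 2) / μ :=
    div_le_div_of_nonneg_right (setIntegral_mono_set hf2
      (Eventually.of_forall fun t => sq_nonneg _) hsub.eventuallyLE) hμ.le
  linarith

end IsApproxSolution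

/-- The energy estimate is stated for `b < T`; continuity of the integral in its upper limit carries
the bound to `T`. -/
theorem setIntegral_Ioo_le_of_forall_lt {h : ℝ → ℝ} {T c : ℝ} (hT : 0 < T)
    (hi : IntegrableOn h (Ioo 0 T)) (hc : ∀ b, 0 < b → b < T → ∫ t in Ioo 0 b, h t ≤ c) :
    ∫ t in Ioo 0 T, h t ≤ c := by
  have hi' : Integrable ((Ioo 0 T).indicator h) := (integrable_indicator_iff measurableSet_Ioo).2 hi
  have e : ∀ b, 0 < b → b ≤ T →
      ∫ t in Ioo 0 b, h t = ∫ t in (0 : ℝ)..b, (Ioo 0 T).indicator h t := fun b hb hbT => by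
    rw [intervalIntegral.integral_of_le hb.le, integral_Ioc_eq_integral_Ioo]
    refine setIntegral_congr_fun measurableSet_Ioo fun t ht => ?_
    rw [indicator_of_mem (show t ∈ Ioo 0 T from ⟨ht.1, ht.2.trans_le hbT⟩)]
  have hcont : Continuous fun b => ∫ t in (0 : ℝ)..b, (Ioo 0 T).indicator h t :=
    intervalIntegral.continuous_primitive (fun _ _ => hi'.intervalIntegrable) 0
  rw [e T hT le_rfl]
  refine le_of_tendsto ((hcont.tendsto T).mono_left (nhdsWithin_le_nhds (s := Iio T))) ?_
  filter_upwards [Ioo_mem_nhdsLT hT] with b hb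
  rw [← e b hb.1 hb.2.le]
  exact hc b hb.1 hb.2

theorem eLpNorm_two_le_of_integral_sq_le {α F : Type*} [MeasurableSpace α] {ν : Measure α}
    [NormedAddCommGroup F] {h : α → F} {c : ℝ} (hh : MemLp h 2 ν) (hc : ∫ x, ‖h x‖ ^ 2 ∂ν ≤ c) :
    eLpNorm h 2 ν ≤ ENNReal.ofReal (√c) := by
  rw [hh.eLpNorm_eq_integral_rpow_norm (by simp) (by simp)]
  refine ENNReal.ofReal_le_ofReal ?_
  simp only [ENNReal.toReal_ofNat, Real.rpow_ofNat]
  rw [Real.sqrt_eq_rpow, ← one_div]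
  exact Real.rpow_le_rpow (integral_nonneg fun _ => by positivity) hc (by norm_num)

/-- The `L²` norm of the yield stress on `Ω`. -/
def yieldNorm (Ω : Opens Plane) (τy : ℝ) : ℝ :=
  τy * (volume (Ω : Set Plane) ^ (1 / 2 : ℝ)).toReal

theorem yieldNorm_nonneg (hτy : 0 ≤ τy) : 0 ≤ yieldNorm Ω τy :=
  mul_nonneg hτy ENNReal.toReal_nonneg

/-- The bound for the energy. -/
def energyBound (T μ : ℝ) (f : ℝ → StrongDual ℝ (V Ω)) (u₀ : H Ω) : ℝ :=
  ‖u₀‖ ^ 2 + (∫ t in Ioo 0 T, ‖f t‖ ^ 2) / μ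

theorem eLpNorm_dual_sub_add_le {α E : Type*} [MeasurableSpace α] {ν : Measure α}
    [NormedAddCommGroup E] [NormedSpace ℝ E] {g f A B : α → StrongDual ℝ E} {a b : ℝ≥0∞}
    (hf : MemLp f 2 ν) (hA : MemLp A 2 ν) (hB : MemLp B 2 ν)
    (h : ∀ᵐ t ∂ν, g t = f t - A t + B t) (ha : eLpNorm A 2 ν ≤ a) (hb : eLpNorm B 2 ν ≤ b) :
    eLpNorm g 2 ν ≤ eLpNorm f 2 ν + a + b := by
  rw [eLpNorm_congr_ae (g := f - A + B) h]
  refine (eLpNorm_add_le (hf.sub hA).1 hB.1 one_le_two).trans (add_le_add ?_ hb)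
  exact (eLpNorm_sub_le hf.1 hA.1 one_le_two).trans (add_le_add_right ha _)

theorem eLpNorm_dual_comp_le {α E F : Type*} [MeasurableSpace α] {ν : Measure α}
    [NormedAddCommGroup E] [NormedSpace ℝ E] [NormedAddCommGroup F] [NormedSpace ℝ F]
    {A : F →L[ℝ] StrongDual ℝ E} (hA : ∀ x, ‖A x‖ ≤ ‖x‖) (S : α → F) :
    eLpNorm (fun t => A (S t)) 2 ν ≤ eLpNorm S 2 ν :=
  eLpNorm_mono fun t => hA (S t)

theorem eLpNorm_divDual_le {α : Type*} [MeasurableSpace α] {ν : Measure α} (S : α → L2mat Ω) :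
    eLpNorm (fun t => divDual (S t)) 2 ν ≤ eLpNorm S 2 ν :=
  eLpNorm_dual_comp_le norm_divDual_le S

theorem exists_stress_representative {ν : Measure ℝ} [SFinite ν] {S : ℝ → L2mat Ω}
    (hS : MemLp S 2 ν) : ∃ S' : Plane × ℝ → Mat,
      (∀ᵐ t ∂ν, ∀ᵐ x ∂volume.restrict (Ω : Set Plane), S' (x, t) = S t x) ∧
      MemLp S' 2 ((volume.restrict (Ω : Set Plane)).prod ν) ∧
      eLpNorm S' 2 ((volume.restrict (Ω : Set Plane)).prod ν) = eLpNorm S 2 ν := by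
  have : Fact ((2 : ℝ≥0∞) ≠ ⊤) := ⟨by simp⟩
  obtain ⟨S', hm, h⟩ := exists_stronglyMeasurable_uncurry hS.1
  have e := eLpNorm_two_prod hm.aestronglyMeasurable h
  exact ⟨S', h, ⟨hm.aestronglyMeasurable, e ▸ hS.2⟩, e⟩

namespace IsApproxSolution

theorem exists_memLp_stress (hs : IsApproxSolution T μ τy f u₀ m u g)
    (hΩ : volume (Ω : Set Plane) ≠ ⊤) (hμ : 0 < μ) (hτy : 0 ≤ τy) (hm : 2 ≤ m) :
    ∃ S : ℝ → L2mat Ω, (∀ t, S t =ᵐ[volume.restrict (Ω : Set Plane)]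
        fun x => biviscosity μ τy m (strain (u t) x)) ∧ MemLp S 2 (timeMeasure T) ∧
      eLpNorm S 2 (timeMeasure T) ≤ ENNReal.ofReal (2 * μ) * eLpNorm u 2 (timeMeasure T) +
        ENNReal.ofReal (yieldNorm Ω τy) * timeMeasure T univ ^ (1 / 2 : ℝ) := by
  obtain ⟨N, hN, hNe⟩ := exists_stress (Ω := Ω) hμ hτy hm
  have hb : eLpNorm (fun t => N (V.gradL (u t))) 2 (timeMeasure T) ≤
      ENNReal.ofReal (2 * μ) * eLpNorm u 2 (timeMeasure T) +
        ENNReal.ofReal (yieldNorm Ω τy) * timeMeasure T univ ^ (1 / 2 : ℝ) :=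
    eLpNorm_two_le_of_norm_le_add hs.memLp.1 (by positivity) (yieldNorm_nonneg hτy)
      (Eventually.of_forall fun t => norm_stress_le hΩ hμ hτy hm (hNe (V.gradL (u t))))
  refine ⟨fun t => N (V.gradL (u t)), fun t => hNe _, ⟨?_, hb.trans_lt ?_⟩, hb⟩
  · exact (hN.comp V.gradL.continuous).comp_aestronglyMeasurable hs.memLp.1
  · have := hs.memLp.2.ne
    finiteness

theorem memLp_tensor (hs : IsApproxSolution T μ τy f u₀ m u g) :
    MemLp (fun t => tensor (u t).toH10 (u t).toH10) 2 (timeMeasure T) := by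
  obtain ⟨c, hc⟩ := hs.exists_norm_toH_le
  exact Bingham.memLp_tensor hs.memLp hs.aestronglyMeasurable_toH hc

/-- Each bound keeps one of the two nonnegative terms of the energy estimate and drops the other. -/
theorem bounds (hs : IsApproxSolution T μ τy f u₀ m u g) (hΩ : volume (Ω : Set Plane) ≠ ⊤)
    (hT : 0 < T) (hμ : 0 < μ) (hτy : 0 ≤ τy) (hm : 2 ≤ m) (hf : MemLp f 2 (timeMeasure T)) :
    (∀ᵐ t ∂timeMeasure T, ‖V.toH (u t)‖ ≤ √(energyBound T μ f u₀)) ∧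
      eLpNorm u 2 (timeMeasure T) ≤ ENNReal.ofReal (√(energyBound T μ f u₀ / μ)) := by
  obtain ⟨S, hS, hSm, -⟩ := hs.exists_memLp_stress hΩ hμ hτy hm
  obtain ⟨U, hU, hU0, huU⟩ := hs.initial
  have hE := fun b (hb : 0 < b) (hbT : b < T) =>
    hs.energy_le hμ hτy hm hf hSm hS hs.memLp_tensor hU hU0 huU hb hbT
  constructor
  · filter_upwards [huU, ae_restrict_mem measurableSet_Ioo] with t h1 h2
    rw [h1]
    refine Real.le_sqrt_of_sq_le ((le_add_of_nonneg_right ?_).trans (hE t h2.1 h2.2))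
    exact mul_nonneg hμ.le (integral_nonneg fun _ => sq_nonneg _)
  · refine eLpNorm_two_le_of_integral_sq_le hs.memLp ?_
    refine setIntegral_Ioo_le_of_forall_lt hT (hs.memLp.integrable_norm_pow (by simp))
      fun b hb hbT => ?_
    rw [le_div_iff₀' hμ]
    exact (le_add_of_nonneg_left (sq_nonneg _)).trans (hE b hb hbT)

end IsApproxSolution

end Bingham

end

/-! ### The uniform bounds -/

theorem proposition1 (Ω : Opens Bingham.Plane) (hΩ : volume (Ω : Set Bingham.Plane) ≠ ⊤)
    (T μ τy : ℝ) (hT : 0 < T) (hμ : 0 < μ) (hτy : 0 ≤ τy)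
    (f : ℝ → Bingham.V' Ω) (hf : MemLp f 2 (Bingham.timeMeasure T)) (u₀ : Bingham.H Ω) :
    ∃ C : NNReal, ∀ m : ℕ, 2 ≤ m → ∀ (u : ℝ → Bingham.V Ω) (g : ℝ → Bingham.V' Ω),
      Bingham.IsApproxSolution T μ τy f u₀ m u g →
      -- `u` in `L²(0,T;V)`
      (MemLp u 2 (Bingham.timeMeasure T) ∧ eLpNorm u 2 (Bingham.timeMeasure T) ≤ C) ∧
      -- `u` in `L^∞(0,T;H)`
      (MemLp (fun t => Bingham.V.toH (u t)) ⊤ (Bingham.timeMeasure T) ∧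
        eLpNorm (fun t => Bingham.V.toH (u t)) ⊤ (Bingham.timeMeasure T) ≤ C) ∧
      -- `(u · ∇) u` in `L²(0,T;V')`
      (∃ B : ℝ → Bingham.V' Ω,
        (∀ᵐ t ∂Bingham.timeMeasure T, ∀ φ : Bingham.V Ω,
          IntegrableOn (fun x => ⟪Bingham.convect (u t) x, Bingham.V.toL2 φ x⟫) Ω ∧
          B t φ = ∫ x in (Ω : Set Bingham.Plane),
            ⟪Bingham.convect (u t) x, Bingham.V.toL2 φ x⟫) ∧
        MemLp B 2 (Bingham.timeMeasure T) ∧ eLpNorm B 2 (Bingham.timeMeasure T) ≤ C) ∧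
      -- `τₘ(Du)` in `L²(Ω × (0,T))`
      (∃ S : Bingham.Plane × ℝ → Bingham.Mat,
        (∀ᵐ t ∂Bingham.timeMeasure T, ∀ᵐ x ∂volume.restrict (Ω : Set Bingham.Plane),
          S (x, t) = Bingham.biviscosity μ τy m (Bingham.strain (u t) x)) ∧
        MemLp S 2 (volume.restrict ((Ω : Set Bingham.Plane) ×ˢ Ioo 0 T)) ∧
        eLpNorm S 2 (volume.restrict ((Ω : Set Bingham.Plane) ×ˢ Ioo 0 T)) ≤ C) ∧
      -- `∂ₜu` in `L²(0,T;V')`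
      (MemLp g 2 (Bingham.timeMeasure T) ∧ eLpNorm g 2 (Bingham.timeMeasure T) ≤ C) := by
  open Bingham in
  have hf' : MemLp (fun t => (f t : StrongDual ℝ (V Ω))) 2 (timeMeasure T) := hf
  have hf_top : eLpNorm (fun t => (f t : StrongDual ℝ (V Ω))) 2 (timeMeasure T) ≠ ⊤ := hf'.2.ne
  -- All constants are fixed before `m` and `u` appear. In `cB`, one factor of `u` is measured in
  -- `L^∞(0,T;H)` and the other in `L²(0,T;V)`; `cg` adds the bounds of the terms of the equation.
  -- Their sum serves as the common `C`.
  let K := energyBound T μ f u₀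
  let cu : ℝ≥0∞ := ENNReal.ofReal (√(K / μ))
  let cH : ℝ≥0∞ := ENNReal.ofReal (√K)
  let cB : ℝ≥0∞ := ENNReal.ofReal (‖outerL‖ * ladyzhenskayaConst Ω * √K) * cu
  let cS : ℝ≥0∞ := ENNReal.ofReal (2 * μ) * cu +
    ENNReal.ofReal (yieldNorm Ω τy) * timeMeasure T univ ^ (1 / 2 : ℝ)
  let cg : ℝ≥0∞ := eLpNorm (fun t => (f t : StrongDual ℝ (V Ω))) 2 (timeMeasure T) + cS + cB
  have htop : cu + cH + cg ≠ ⊤ := by finiteness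
  refine ⟨(cu + cH + cg).toNNReal, fun m hm u g hs => ?_⟩
  rw [ENNReal.coe_toNNReal htop]
  have hcu : cu ≤ cu + cH + cg := le_self_add.trans le_self_add
  have hcH : cH ≤ cu + cH + cg := le_add_self.trans le_self_add
  have hcg : cg ≤ cu + cH + cg := le_add_self
  have hcS : cS ≤ cu + cH + cg := (le_add_self.trans le_self_add).trans hcg
  have hcB : cB ≤ cu + cH + cg := le_add_self.trans hcg
  obtain ⟨hH, hu⟩ := IsApproxSolution.bounds hs hΩ hT hμ hτy hm hf'
  obtain ⟨S, hS, hSm, hSb⟩ := IsApproxSolution.exists_memLp_stress hs hΩ hμ hτy hm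
  have hSb' : eLpNorm S 2 (timeMeasure T) ≤ cS :=
    hSb.trans (add_le_add (mul_le_mul' le_rfl hu) le_rfl)
  have hBm := IsApproxSolution.memLp_tensor hs
  have hBb : eLpNorm (fun t => tensor (u t).toH10 (u t).toH10) 2 (timeMeasure T) ≤ cB :=
    (eLpNorm_le_mul_eLpNorm_of_ae_le_mul
      (hH.mono fun t ht => norm_tensor_self_le_mul ht) 2).trans (mul_le_mul' le_rfl hu)
  have hSd := memLp_dual_comp divDual hSm
  have hBd := memLp_dual_comp divDual hBm
  refine ⟨⟨hs.memLp, hu.trans hcu⟩, ?_, ?_, ?_, hs.memLp_deriv, ?_⟩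
  · have hb := eLpNorm_le_of_ae_bound (p := ⊤) hH
    simp only [ENNReal.toReal_top, inv_zero, ENNReal.rpow_zero, one_mul] at hb
    exact ⟨⟨IsApproxSolution.aestronglyMeasurable_toH hs, hb.trans_lt ENNReal.ofReal_lt_top⟩,
      hb.trans hcH⟩
  -- The minus sign comes from the integration by parts. The representation holds at every time, not
  -- only almost every one.
  · refine ⟨fun t => -divDual (tensor (u t).toH10 (u t).toH10), Eventually.of_forall fun t φ =>
      ⟨integrableOn_inner_convect (u t) φ, (integral_inner_convect (u t) φ).symm⟩, hBd.neg, ?_⟩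
    exact (eLpNorm_neg _ _ _).trans_le ((eLpNorm_divDual_le _).trans (hBb.trans hcB))
  · obtain ⟨S', hS', hm', hb'⟩ := exists_stress_representative hSm
    rw [Measure.volume_eq_prod, ← Measure.prod_restrict]
    refine ⟨S', ?_, hm', hb'.trans_le (hSb'.trans hcS)⟩
    filter_upwards [hS'] with t ht
    filter_upwards [ht, hS t] with x h1 h2
    rw [h1, h2]
  · exact (eLpNorm_dual_sub_add_le hf' hSd hBd (IsApproxSolution.equation_ae hs hf' hSm hS hBm)
      ((eLpNorm_divDual_le _).trans hSb') ((eLpNorm_divDual_le _).trans hBb)).trans hcg
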